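/- Let $A$ and $B$ be skew shapes (each is the set of boxes $\lambda/\mu$ of a Young diagram $\lambda$ with a Young diagram $\mu\subseteq\lambda$ removed). Let $s_A=\sum_T x^T$ be the skew Schur function of $A$, the sum over all semistandard Young tableaux of shape $A$. The Schur support of $A$ is the set of partitions $\nu$ such that $s_\nu$ has nonzero coefficient in the expansion of $s_A$ as a linear combination of Schur functions. The $F$-support of $A$ is the set of compositions $\alpha$ such that $F_\alpha$ has positive coefficient in the expansion of $s_A$ in the basis of fundamental quasisymmetric functions $$F_\alpha=\sum_{S(\alpha)\subseteq S(\beta),\ |\beta|=|\alpha|}M_\beta,\qquad M_\beta=\sum_{i_1<\cdots<i_m}x_{i_1}^{\beta_1}\cdots x_{i_m}^{\beta_m},\qquad S(\alpha)=\{\alpha_1,\ \alpha_1+\alpha_2,\ \ldots,\ \alpha_1+\cdots+\alpha_{p-1}\},$$ where $\alpha=(\alpha_1,\ldots,\alpha_p)$ and $\beta=(\beta_1,\ldots,\beta_m)$ are compositions. For $k\ge 1$, let $\mathrm{rows}_k(A)$ be the partition obtained by taking, for every $k$ consecutive rows of $A$, the number of columns that these rows occupy in common, and sorting these numbers into weakly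 decreasing order (zeros omitted). Let $\mathrm{cols}_\ell(A)$, $\ell\ge1$, be the partition defined in the same way with rows and columns exchanged, and let $\mathrm{rects}_{k,\ell}(A)$ be the number of $k\times\ell$ rectangular subdiagrams (with $k$ consecutive rows and $\ell$ consecutive columns) contained in $A$. If $s_A=s_B$, or $A$ and $B$ have equal Schur supports, or $A$ and $B$ have equal $F$-supports, then - $\mathrm{rows}_k(A)=\mathrm{rows}_k(B)$ for all $k\ge1$; - $\mathrm{cols}_\ell(A)=\mathrm{cols}_\ell(B)$ for all $\ell\ge1$; - $\mathrm{rects}_{k,\ell}(A)=\mathrm{rects}_{k,\ell}(B)$ for all $k,\ell\ge1$. -/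

import Mathlib

/-- A skew shape `outer / inner`, given by two Young diagrams with `inner ⊆ outer`.  Cells are
pairs `(row, column)` in English notation, both indices starting at `0`. -/
structure SkewShape where
  outer : YoungDiagram
  inner : YoungDiagram
  inner_le_outer : inner ≤ outer

/-- The straight shape `ν / ∅`. -/
def SkewShape.straight (ν : YoungDiagram) : SkewShape := ⟨ν, ⊥, bot_le⟩

namespace SkewShape

/-- The boxes of a skew shape. -/
def cells (A : SkewShape) : Finset (ℕ × ℕ) := A.outer.cells \ A.inner.cells

/-- The number of columns occupied in common by the `k` consecutive rows `i, …, i + k - 1`. -/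
def rowOverlap (A : SkewShape) (k i : ℕ) : ℕ :=
  {j ∈ A.cells.image Prod.snd | ∀ a < k, (i + a, j) ∈ A.cells}.card

/-- The number of rows occupied in common by the `k` consecutive columns `j, …, j + k - 1`. -/
def colOverlap (A : SkewShape) (k j : ℕ) : ℕ :=
  {i ∈ A.cells.image Prod.fst | ∀ b < k, (i, j + b) ∈ A.cells}.card

/-- The partition `rows_k(A)`, for `k ≥ 1`: the row overlaps of `k` consecutive rows, sorted into
weakly decreasing order.  As for any partition, zero entries are not recorded. -/
def rowsk (A : SkewShape) (k : ℕ) : List ℕ :=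
  (((Multiset.range (A.outer.colLen 0 + 1 - k)).map (A.rowOverlap k)).filter (0 < ·)).sort
    (· ≥ ·)

/-- The partition `cols_k(A)`, for `k ≥ 1`: the column overlaps of `k` consecutive columns, sorted
into weakly decreasing order.  As for any partition, zero entries are not recorded. -/
def colsk (A : SkewShape) (k : ℕ) : List ℕ :=
  (((Multiset.range (A.outer.rowLen 0 + 1 - k)).map (A.colOverlap k)).filter (0 < ·)).sort
    (· ≥ ·)

/-- The number of `k × l` rectangular subdiagrams contained in `A`, for `k, l ≥ 1`; they are counted
by their top left box. -/
def rects (A : SkewShape) (k l : ℕ) : ℕ :=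
  {c ∈ A.cells | ∀ a < k, ∀ b < l, (c.1 + a, c.2 + b) ∈ A.cells}.card

/-- Semistandard Young tableaux of skew shape `A`: entries increase weakly along rows and strictly
down columns. -/
structure SSYT (A : SkewShape) where
  entry : A.cells → ℕ
  row_weak : ∀ c d : A.cells, c.1.1 = d.1.1 → c.1.2 < d.1.2 → entry c ≤ entry d
  col_strict : ∀ c d : A.cells, c.1.2 = d.1.2 → c.1.1 < d.1.1 → entry c < entry d

/-- The exponent vector of the monomial `x^T = ∏ x_{T(c)}`, the product over all boxes `c`. -/
noncomputable def SSYT.content {A : SkewShape} (T : A.SSYT) : ℕ →₀ ℕ :=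
  ∑ c, Finsupp.single (T.entry c) 1

end SkewShape

/-- The formal power series `∑ i, x^(e i)` in the variables `x_0, x_1, …`, for a family of exponent
vectors in which each vector occurs only finitely often: the coefficient of `x^d` is the number of
indices `i` with `e i = d`. -/
noncomputable def monomialSum {ι : Type} (e : ι → (ℕ →₀ ℕ)) : MvPowerSeries ℕ ℚ :=
  fun d => (Nat.card {i // e i = d} : ℚ)

/-- The skew Schur function `s_A = ∑ x^T`, the sum over all semistandard tableaux `T` of shape
`A`. -/
noncomputable def skewSchur (A : SkewShape) : MvPowerSeries ℕ ℚ :=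
  monomialSum (SkewShape.SSYT.content (A := A))

/-- The Schur function `s_ν` of a partition `ν`, given by its Young diagram. -/
noncomputable def schur (ν : YoungDiagram) : MvPowerSeries ℕ ℚ :=
  skewSchur (SkewShape.straight ν)

/-- The set `S(α) = {α₁, α₁ + α₂, …, α₁ + ⋯ + α_{k-1}}` of a composition `α = (α₁, …, α_k)`. -/
def Composition.partialSums {n : ℕ} (α : Composition n) : Finset ℕ :=
  (Finset.Ico 1 α.length).image α.sizeUpTo

/-- The monomial quasisymmetric function
`M_α = ∑ x_{i₁}^{α₁} ⋯ x_{i_k}^{α_k}`, the sum over `i₁ < ⋯ < i_k`. -/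
noncomputable def monomialQSym {n : ℕ} (α : Composition n) : MvPowerSeries ℕ ℚ :=
  monomialSum fun i : Fin α.length ↪o ℕ => ∑ j, Finsupp.single (i j) (α.blocksFun j)

/-- The fundamental quasisymmetric function `F_α`, the sum of all `M_β` with `|β| = |α|` and
`S(α) ⊆ S(β)`.  The index is a composition together with its size. -/
noncomputable def fundamentalQSym (α : Σ n, Composition n) : MvPowerSeries ℕ ℚ :=
  ∑ β : Composition α.1 with α.2.partialSums ⊆ β.partialSums, monomialQSym β

/-- The Schur support of `A`: the partitions `ν` such that `s_ν` has nonzero coefficient in the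
expansion of `s_A` as a linear combination of Schur functions. -/
def schurSupport (A : SkewShape) : Set YoungDiagram :=
  {ν | ∃ c : YoungDiagram →₀ ℚ, Finsupp.linearCombination ℚ schur c = skewSchur A ∧ c ν ≠ 0}

/-- The `F`-support of `A`: the compositions `α` such that `F_α` has positive coefficient in the
expansion of `s_A` as a linear combination of fundamental quasisymmetric functions. -/
def fundamentalSupport (A : SkewShape) : Set (Σ n, Composition n) :=
  {α | ∃ c : (Σ n, Composition n) →₀ ℚ,
    Finsupp.linearCombination ℚ fundamentalQSym c = skewSchur A ∧ 0 < c α}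

/-!
Let `b` be the family of the Schur functions or of the fundamental quasisymmetric functions. In each
member of `b` the coefficient of the highest power of `x_0` is again a member of `b`, and the member
is determined by that power and that coefficient. In `s_A`, the highest power of `x_0` is the number
of columns of `A`, and its coefficient is the skew Schur function of the shape obtained by deleting
the last box of every column. Hence the support of `s_A` in `b` determines the number of columns of
`A` and the support of the shrunken shape. The involution `ω`, which permutes `b` and maps `s_A` to
`s_{Aᵀ}`, yields the same for rows.

Deleting the last box of every column (of every row) lowers one side of every rectangle in `A` by
one, so the number of `k × l` rectangles in `A` is the number of boxes of an iterated shrinking, and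
the number of boxes is the total number of columns removed by repeated shrinking. For fixed `k`, the
rectangle counts are sums of truncated row overlaps, whose second differences in `l` are the
multiplicities of the parts of `rows_k(A)`.
-/

/-! ### Rectangles and overlaps -/

theorem multiset_sum_map_tsub_add (s : Multiset ℕ) (l : ℕ) :
    (s.map (· + 1 - l)).sum + (s.map (· + 1 - (l + 2))).sum =
      2 * (s.map (· + 1 - (l + 1))).sum + s.count l := by
  induction s using Multiset.induction with
  | empty => simp
  | cons a s ih =>
    simp only [Multiset.map_cons, Multiset.sum_cons, Multiset.count_cons]
    split_ifs <;> omega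

theorem multiset_filter_pos_eq_of_sum_map_tsub_eq {s t : Multiset ℕ}
    (h : ∀ l, 1 ≤ l → (s.map (· + 1 - l)).sum = (t.map (· + 1 - l)).sum) :
    s.filter (0 < ·) = t.filter (0 < ·) := by
  ext l
  rw [Multiset.count_filter, Multiset.count_filter]
  split_ifs with hl
  · -- `count l` is the second difference of the truncated sums at `l`.
    have hs := multiset_sum_map_tsub_add s l
    have ht := multiset_sum_map_tsub_add t l
    have h0 := h l hl
    have h1 := h (l + 1) (by omega)
    have h2 := h (l + 2) (by omega)
    omega
  · rfl

/-- The Young diagram of the partition `(ν₂, ν₃, …)`. -/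
noncomputable def tailRows (ν : YoungDiagram) : YoungDiagram where
  cells := ν.cells.preimage (Prod.map Nat.succ id)
    (Nat.succ_injective.prodMap Function.injective_id).injOn
  isLowerSet := fun _ _ hdc hc => by
    simp only [Finset.coe_preimage, Set.mem_preimage] at hc ⊢
    exact ν.isLowerSet (Prod.mk_le_mk.2 ⟨Nat.succ_le_succ hdc.1, hdc.2⟩) hc

theorem mem_tailRows {ν : YoungDiagram} {i j : ℕ} : (i, j) ∈ tailRows ν ↔ (i + 1, j) ∈ ν := by
  rw [← YoungDiagram.mem_cells, ← YoungDiagram.mem_cells]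
  exact Finset.mem_preimage (hf := (Nat.succ_injective.prodMap Function.injective_id).injOn)

namespace SkewShape

variable {A B : SkewShape} {k l : ℕ}

theorem mem_cells {c : ℕ × ℕ} : c ∈ A.cells ↔ c ∈ A.outer ∧ c ∉ A.inner := by
  simp [cells]

theorem mem_cells_iff_rowLen {i j : ℕ} :
    (i, j) ∈ A.cells ↔ A.inner.rowLen i ≤ j ∧ j < A.outer.rowLen i := by
  rw [mem_cells, YoungDiagram.mem_iff_lt_rowLen, YoungDiagram.mem_iff_lt_rowLen, not_lt, and_comm]

theorem ordConnected_cells (A : SkewShape) : (A.cells : Set (ℕ × ℕ)).OrdConnected := by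
  refine ⟨fun c hc e he d hd => ?_⟩
  rw [Finset.mem_coe, mem_cells] at *
  exact ⟨A.outer.isLowerSet hd.2 he.1, fun h => hc.2 (A.inner.isLowerSet hd.1 h)⟩

/-- The skew shape with rows and columns exchanged. -/
def transpose (A : SkewShape) : SkewShape :=
  ⟨A.outer.transpose, A.inner.transpose, YoungDiagram.transpose_mono A.inner_le_outer⟩

theorem mem_cells_transpose {c : ℕ × ℕ} : c ∈ A.transpose.cells ↔ c.swap ∈ A.cells := by
  simp [mem_cells, transpose]

theorem transpose_straight (ν : YoungDiagram) :
    (straight ν).transpose = straight ν.transpose := by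
  have : (⊥ : YoungDiagram).transpose = ⊥ := by ext; simp
  simp [transpose, straight, this]

/-- The skew shape obtained by removing the last box of every nonempty column.  Its boxes are the
top boxes of the vertical dominoes contained in `A`, so that passing to it shortens every rectangle
by one row. -/
noncomputable def shrink (A : SkewShape) : SkewShape :=
  ⟨A.inner ⊔ tailRows A.outer, A.inner, le_sup_left⟩

theorem mem_cells_shrink {i j : ℕ} :
    (i, j) ∈ A.shrink.cells ↔ (i, j) ∈ A.cells ∧ (i + 1, j) ∈ A.cells := by
  simp only [mem_cells, shrink, YoungDiagram.mem_sup, mem_tailRows]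
  have houter : (i + 1, j) ∈ A.outer → (i, j) ∈ A.outer := A.outer.up_left_mem (by simp) le_rfl
  have hinner : (i + 1, j) ∈ A.inner → (i, j) ∈ A.inner := A.inner.up_left_mem (by simp) le_rfl
  tauto

theorem shrink_straight (ν : YoungDiagram) : (straight ν).shrink = straight (tailRows ν) := by
  simp [shrink, straight]

theorem rects_one_one (A : SkewShape) : A.rects 1 1 = A.cells.card := by
  simp [rects]

theorem rects_transpose (A : SkewShape) (k l : ℕ) : A.transpose.rects k l = A.rects l k := by
  refine Finset.card_nbij' Prod.swap Prod.swap ?_ ?_ (fun _ _ => rfl) (fun _ _ => rfl) <;>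
  · rintro ⟨i, j⟩ h
    simp only [Finset.coe_filter, Set.mem_ofPred_eq, mem_cells_transpose, Prod.swap] at h ⊢
    exact ⟨h.1, fun a ha b hb => h.2 b hb a ha⟩

theorem rects_succ_left (A : SkewShape) (hk : 1 ≤ k) (hl : 1 ≤ l) :
    A.rects (k + 1) l = A.shrink.rects k l := by
  unfold rects
  congr 1
  ext ⟨i, j⟩
  simp only [Finset.mem_filter, mem_cells_shrink]
  constructor
  · rintro ⟨h, h'⟩
    exact ⟨⟨h, h' 1 (by omega) 0 hl⟩, fun a ha b hb =>
      ⟨h' a (by omega) b hb, add_assoc i a 1 ▸ h' (a + 1) (by omega) b hb⟩⟩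
  · rintro ⟨⟨h, -⟩, h'⟩
    refine ⟨h, fun a ha b hb => ?_⟩
    rcases a with - | a
    · exact (h' 0 hk b hb).1
    · exact (h' a (by omega) b hb).2

theorem rects_succ_right (A : SkewShape) (hk : 1 ≤ k) (hl : 1 ≤ l) :
    A.rects k (l + 1) = A.transpose.shrink.transpose.rects k l := by
  rw [rects_transpose, ← rects_succ_left _ hl hk, rects_transpose]

theorem forall_lt_mem_cells_iff (hk : 1 ≤ k) {i j : ℕ} :
    (∀ a < k, (i + a, j) ∈ A.cells) ↔
      A.inner.rowLen i ≤ j ∧ j < A.outer.rowLen (i + (k - 1)) := by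
  simp only [mem_cells_iff_rowLen]
  exact ⟨fun h => ⟨(h 0 hk).1, (h (k - 1) (by omega)).2⟩, fun h a ha =>
    ⟨(A.inner.rowLen_anti i (i + a) (by omega)).trans h.1,
      h.2.trans_le (A.outer.rowLen_anti _ _ (by omega))⟩⟩

theorem rowOverlap_eq (A : SkewShape) (hk : 1 ≤ k) (i : ℕ) :
    A.rowOverlap k i = A.outer.rowLen (i + (k - 1)) - A.inner.rowLen i := by
  rw [rowOverlap, ← Nat.card_Ico]
  congr 1
  ext j
  rw [Finset.mem_filter, Finset.mem_Ico, ← forall_lt_mem_cells_iff hk, and_iff_right_iff_imp]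
  exact fun h => Finset.mem_image.2 ⟨(i, j), h 0 hk, rfl⟩

theorem forall_lt_forall_lt_mem_cells_iff (hk : 1 ≤ k) (hl : 1 ≤ l) {i j : ℕ} :
    (∀ a < k, ∀ b < l, (i + a, j + b) ∈ A.cells) ↔
      A.inner.rowLen i ≤ j ∧ j + l ≤ A.outer.rowLen (i + (k - 1)) := by
  constructor
  · intro h
    have hleft := (forall_lt_mem_cells_iff hk).1 fun a ha => h a ha 0 hl
    have hright := (forall_lt_mem_cells_iff hk).1 fun a ha => h a ha (l - 1) (by omega)
    omega
  · exact fun h a ha b hb => (forall_lt_mem_cells_iff hk).2 (by omega) a ha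

theorem rects_eq_sum_rowOverlap (A : SkewShape) (hk : 1 ≤ k) (hl : 1 ≤ l) :
    A.rects k l = ∑ i ∈ Finset.range (A.outer.colLen 0 + 1 - k), (A.rowOverlap k i + 1 - l) := by
  trans ((Finset.range (A.outer.colLen 0 + 1 - k)).sigma fun i =>
    Finset.Ico (A.inner.rowLen i) (A.outer.rowLen (i + (k - 1)) + 1 - l)).card
  · refine Finset.card_equiv (Equiv.sigmaEquivProd ℕ ℕ).symm fun ⟨i, j⟩ => ?_
    rw [Finset.mem_filter, forall_lt_forall_lt_mem_cells_iff hk hl, mem_cells_iff_rowLen]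
    simp only [Finset.mem_sigma, Finset.mem_range, Finset.mem_Ico, Equiv.sigmaEquivProd_symm_apply]
    have hrow := A.outer.rowLen_anti i (i + (k - 1)) (by omega)
    have hcol : 0 < A.outer.rowLen (i + (k - 1)) → i + (k - 1) < A.outer.colLen 0 := by
      rw [← YoungDiagram.mem_iff_lt_rowLen, ← YoungDiagram.mem_iff_lt_colLen]
      exact id
    omega
  · rw [Finset.card_sigma]
    refine Finset.sum_congr rfl fun i _ => ?_
    rw [A.rowOverlap_eq hk, Nat.card_Ico]
    omega

theorem rowsk_eq_of_rects_eq (hk : 1 ≤ k) (h : ∀ l, 1 ≤ l → A.rects k l = B.rects k l) :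
    A.rowsk k = B.rowsk k := by
  unfold rowsk
  rw [multiset_filter_pos_eq_of_sum_map_tsub_eq]
  intro l hl
  rw [Multiset.map_map, Multiset.map_map]
  exact (A.rects_eq_sum_rowOverlap hk hl).symm.trans
    ((h l hl).trans (B.rects_eq_sum_rowOverlap hk hl))

theorem rowOverlap_transpose (A : SkewShape) (k : ℕ) :
    A.transpose.rowOverlap k = A.colOverlap k := by
  funext i
  unfold rowOverlap colOverlap
  congr 1
  ext j
  simp [mem_cells_transpose, Finset.mem_image]

theorem rowsk_transpose (A : SkewShape) (k : ℕ) : A.transpose.rowsk k = A.colsk k := by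
  unfold colsk rowsk
  rw [rowOverlap_transpose]
  simp [transpose]

theorem colsk_eq_of_rects_eq (hl : 1 ≤ l) (h : ∀ k, 1 ≤ k → A.rects k l = B.rects k l) :
    A.colsk l = B.colsk l := by
  rw [← rowsk_transpose, ← rowsk_transpose]
  refine rowsk_eq_of_rects_eq hl fun k hk => ?_
  rw [rects_transpose, rects_transpose, h k hk]

end SkewShape

/-! ### The highest power of `x_0` in a skew Schur function -/

/-- The exponent vector `(m, d₀, d₁, …)`. -/
noncomputable def natCons (m : ℕ) (d : ℕ →₀ ℕ) : ℕ →₀ ℕ :=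
  Finsupp.single 0 m + d.mapDomain Nat.succ

@[simp]
theorem natCons_zero (m : ℕ) (d : ℕ →₀ ℕ) : natCons m d 0 = m := by
  simp [natCons, Finsupp.mapDomain_of_notMem_range]

@[simp]
theorem natCons_succ (m : ℕ) (d : ℕ →₀ ℕ) (t : ℕ) : natCons m d (t + 1) = d t := by
  simp [natCons, Finsupp.mapDomain_apply Nat.succ_injective]

theorem degree_natCons (m : ℕ) (d : ℕ →₀ ℕ) : (natCons m d).degree = m + d.degree := by
  rw [natCons, map_add, Finsupp.degree_single, Finsupp.degree_mapDomain]

theorem exists_eq_natCons (d : ℕ →₀ ℕ) : ∃ d', d = natCons (d 0) d' := by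
  refine ⟨d.comapDomain Nat.succ Nat.succ_injective.injOn, ?_⟩
  ext t
  cases t <;> simp

theorem natCons_right_injective (m : ℕ) : Function.Injective (natCons m) := by
  intro d e h
  ext t
  simpa using DFunLike.congr_fun h (t + 1)

/-- The coefficient of `x_0 ^ m` in a power series, as a power series in the remaining variables,
renumbered to start with `x_0`. -/
noncomputable def headCoeff (m : ℕ) : MvPowerSeries ℕ ℚ →ₗ[ℚ] MvPowerSeries ℕ ℚ where
  toFun f d := MvPowerSeries.coeff (natCons m d) f
  map_add' _ _ := rfl
  map_smul' _ _ := rfl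

theorem coeff_headCoeff (m : ℕ) (f : MvPowerSeries ℕ ℚ) (d : ℕ →₀ ℕ) :
    MvPowerSeries.coeff d (headCoeff m f) = MvPowerSeries.coeff (natCons m d) f := rfl

namespace SkewShape

variable {A : SkewShape}

/-- The number of nonempty columns, which is the largest exponent of `x_0` in `s_A`. -/
def numCols (A : SkewShape) : ℕ := (A.cells.image Prod.snd).card

theorem numCols_straight (ν : YoungDiagram) : (straight ν).numCols = ν.rowLen 0 := by
  rw [numCols, ← Finset.card_range (ν.rowLen 0)]
  congr 1
  ext j
  simp only [Finset.mem_image, mem_cells, straight, YoungDiagram.notMem_bot, not_false_eq_true,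
    and_true, Finset.mem_range, ← YoungDiagram.mem_iff_lt_rowLen]
  constructor
  · rintro ⟨⟨i, j⟩, h, rfl⟩
    exact ν.up_left_mem (Nat.zero_le _) le_rfl h
  · exact fun h => ⟨_, h, rfl⟩

theorem card_cells_straight (ν : YoungDiagram) : (straight ν).cells.card = ν.card := by
  simp only [cells, straight, YoungDiagram.cells_bot, Finset.sdiff_empty]

namespace SSYT

@[ext]
theorem ext {T U : A.SSYT} (h : ∀ c, T.entry c = U.entry c) : T = U := by
  cases T
  cases U
  congr
  exact funext h

instance : Nonempty A.SSYT :=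
  ⟨⟨fun c => c.1.1, fun _ _ h _ => h.le, fun _ _ _ h => h⟩⟩

theorem content_apply (T : A.SSYT) (t : ℕ) :
    T.content t = (Finset.univ.filter fun c => T.entry c = t).card := by
  simp only [content, Finsupp.finsetSum_apply, Finsupp.single_apply, Finset.card_filter]

theorem degree_content (T : A.SSYT) : T.content.degree = A.cells.card := by
  simp [content]

theorem entry_mem_support_content (T : A.SSYT) (c : A.cells) : T.entry c ∈ T.content.support := by
  rw [Finsupp.mem_support_iff, content_apply, ← Nat.pos_iff_ne_zero, Finset.card_pos]
  exact ⟨c, by simp⟩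

instance finite_content_eq (d : ℕ →₀ ℕ) : Finite {T : A.SSYT // T.content = d} :=
  Finite.of_injective (β := A.cells → d.support)
    (fun T c => ⟨T.1.entry c, by simpa only [T.2] using T.1.entry_mem_support_content c⟩)
    fun _ _ h => Subtype.ext (ext fun c => congrArg Subtype.val (congrFun h c))

theorem entry_le_of_le (T : A.SSYT) {c d : A.cells} (h : c ≤ d) : T.entry c ≤ T.entry d := by
  obtain ⟨⟨i, j⟩, hc⟩ := c
  obtain ⟨⟨i', j'⟩, hd⟩ := d
  obtain ⟨hi, hj⟩ : i ≤ i' ∧ j ≤ j' := h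
  have he : (i, j') ∈ A.cells := A.ordConnected_cells.out hc hd ⟨⟨le_rfl, hj⟩, ⟨hi, le_rfl⟩⟩
  trans T.entry ⟨_, he⟩
  · rcases hj.eq_or_lt with rfl | hj
    exacts [le_rfl, T.row_weak ⟨_, hc⟩ ⟨_, he⟩ rfl hj]
  · rcases hi.eq_or_lt with rfl | hi
    exacts [le_rfl, (T.col_strict ⟨_, he⟩ ⟨_, hd⟩ rfl hi).le]

theorem entry_lt_of_le (T : A.SSYT) {c d : A.cells} (h : c ≤ d) (h' : c.1.1 < d.1.1) :
    T.entry c < T.entry d := by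
  obtain ⟨⟨i, j⟩, hc⟩ := c
  obtain ⟨⟨i', j'⟩, hd⟩ := d
  obtain ⟨hi, hj⟩ : i ≤ i' ∧ j ≤ j' := h
  have he : (i, j') ∈ A.cells := A.ordConnected_cells.out hc hd ⟨⟨le_rfl, hj⟩, ⟨hi, le_rfl⟩⟩
  exact (T.entry_le_of_le (c := ⟨_, hc⟩) (d := ⟨_, he⟩) ⟨le_rfl, hj⟩).trans_lt
    (T.col_strict ⟨_, he⟩ ⟨_, hd⟩ rfl h')

theorem eq_of_entry_eq_of_col_eq (T : A.SSYT) {c d : A.cells} (h : T.entry c = T.entry d)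
    (h' : c.1.2 = d.1.2) : c = d := by
  rcases lt_trichotomy c.1.1 d.1.1 with hlt | heq | hlt
  · exact absurd h (T.col_strict c d h' hlt).ne
  · exact Subtype.ext (Prod.ext heq h')
  · exact absurd h (T.col_strict d c h'.symm hlt).ne'

/-- The columns that contain a `0`. -/
def zeroCols (T : A.SSYT) : Finset ℕ :=
  (Finset.univ.filter fun c => T.entry c = 0).image fun c => c.1.2

theorem zeroCols_subset (T : A.SSYT) : T.zeroCols ⊆ A.cells.image Prod.snd := by
  intro j hj
  obtain ⟨c, -, rfl⟩ := Finset.mem_image.1 hj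
  exact Finset.mem_image_of_mem _ c.2

theorem card_zeroCols (T : A.SSYT) : T.zeroCols.card = T.content 0 := by
  rw [content_apply, zeroCols, Finset.card_image_of_injOn]
  intro c hc d hd h
  simp only [Finset.coe_filter, Finset.mem_univ, true_and, Set.mem_ofPred_eq] at hc hd
  exact T.eq_of_entry_eq_of_col_eq (hc.trans hd.symm) h

theorem content_zero_le (T : A.SSYT) : T.content 0 ≤ A.numCols :=
  T.card_zeroCols ▸ Finset.card_le_card T.zeroCols_subset

theorem content_zero_eq_numCols_iff {T : A.SSYT} :
    T.content 0 = A.numCols ↔ ∀ c : A.cells, ∃ d : A.cells, T.entry d = 0 ∧ d.1.2 = c.1.2 := by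
  rw [← card_zeroCols, numCols]
  constructor
  · intro h c
    have hc := Finset.mem_image_of_mem Prod.snd c.2
    rw [← Finset.eq_of_subset_of_card_le T.zeroCols_subset h.ge] at hc
    simpa [zeroCols] using hc
  · intro h
    refine congrArg Finset.card (T.zeroCols_subset.antisymm fun j hj => ?_)
    obtain ⟨c, hc, rfl⟩ := Finset.mem_image.1 hj
    obtain ⟨d, hd⟩ := h ⟨c, hc⟩
    exact Finset.mem_image.2 ⟨d, by simpa using hd.1, hd.2⟩

theorem entry_eq_zero_of_content_zero_eq {T : A.SSYT} (h : T.content 0 = A.numCols) (c : A.cells)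
    (hc : ∀ d ∈ A.cells, d.2 = c.1.2 → c.1.1 ≤ d.1) : T.entry c = 0 := by
  obtain ⟨d, hd, hdc⟩ := content_zero_eq_numCols_iff.1 h c
  exact Nat.le_zero.1 (hd ▸ T.entry_le_of_le ⟨hc d.1 d.2 hdc, hdc.ge⟩)

/-- The tableau whose columns are those of `T`, increased by one and moved one row down below a new
top entry `0`. -/
def grow (T : A.shrink.SSYT) : A.SSYT where
  entry
    | ⟨(0, _), _⟩ => 0
    | ⟨(i + 1, j), hc⟩ =>
      if h : (i, j) ∈ A.cells then T.entry ⟨(i, j), mem_cells_shrink.2 ⟨h, hc⟩⟩ + 1 else 0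
  row_weak := by
    rintro ⟨⟨_ | i, j⟩, hc⟩ ⟨⟨_, j'⟩, hd⟩ rfl hj
    · exact le_rfl
    · dsimp only at hj ⊢
      split_ifs with h h'
      · exact Nat.succ_le_succ (T.row_weak _ _ rfl hj)
      · exact (h' (A.ordConnected_cells.out h hd
          ⟨⟨le_rfl, hj.le⟩, ⟨Nat.le_succ i, le_rfl⟩⟩)).elim
      · exact Nat.zero_le _
      · exact le_rfl
  col_strict := by
    rintro ⟨⟨i, j⟩, hc⟩ ⟨⟨_ | i', _⟩, hd⟩ rfl hi
    · exact absurd hi (Nat.not_lt_zero _)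
    · have h' : (i', j) ∈ A.cells :=
        A.ordConnected_cells.out hc hd ⟨⟨Nat.le_of_lt_succ hi, le_rfl⟩, ⟨by simp, le_rfl⟩⟩
      rcases i with _ | i
      · simp [h']
      · dsimp only at hi ⊢
        rw [dif_pos h']
        split_ifs
        exacts [Nat.succ_lt_succ (T.col_strict _ _ rfl (Nat.succ_lt_succ_iff.1 hi)),
          Nat.succ_pos _]

theorem entry_grow_succ (T : A.shrink.SSYT) {i j : ℕ} (h : (i, j) ∈ A.shrink.cells) :
    T.grow.entry ⟨(i + 1, j), (mem_cells_shrink.1 h).2⟩ = T.entry ⟨(i, j), h⟩ + 1 := by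
  simp [grow, (mem_cells_shrink.1 h).1]

theorem content_grow_succ (T : A.shrink.SSYT) (t : ℕ) : T.grow.content (t + 1) = T.content t := by
  rw [content_apply, content_apply]
  symm
  refine Finset.card_bij (fun c _ => ⟨(c.1.1 + 1, c.1.2), (mem_cells_shrink.1 c.2).2⟩) ?_ ?_ ?_
  · rintro ⟨⟨i, j⟩, hc⟩ h
    simpa [entry_grow_succ T hc] using h
  · rintro ⟨⟨i, j⟩, hc⟩ - ⟨⟨i', j'⟩, hd⟩ - h
    simpa using h
  · rintro ⟨⟨_ | i, j⟩, hc⟩ h <;> rw [Finset.mem_filter] at h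
    · simp [grow] at h
    · by_cases hij : (i, j) ∈ A.cells
      · exact ⟨⟨(i, j), mem_cells_shrink.2 ⟨hij, hc⟩⟩, by simpa [grow, hij] using h, rfl⟩
      · simp [grow, hij] at h

theorem content_grow_zero (T : A.shrink.SSYT) : T.grow.content 0 = A.numCols := by
  rw [content_zero_eq_numCols_iff]
  rintro ⟨⟨i, j⟩, hc⟩
  induction i with
  | zero => exact ⟨⟨(0, j), hc⟩, rfl, rfl⟩
  | succ i ih =>
    by_cases hij : (i, j) ∈ A.cells
    · exact ih hij
    · exact ⟨⟨(i + 1, j), hc⟩, by simp [grow, hij], rfl⟩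

theorem content_grow (T : A.shrink.SSYT) : T.grow.content = natCons A.numCols T.content := by
  ext t
  cases t with
  | zero => rw [content_grow_zero, natCons_zero]
  | succ t => rw [content_grow_succ, natCons_succ]

/-- The inverse of `grow` on the tableaux with a `0` in every column. -/
def peel (U : A.SSYT) : A.shrink.SSYT where
  entry c := U.entry ⟨(c.1.1 + 1, c.1.2), (mem_cells_shrink.1 c.2).2⟩ - 1
  row_weak _ _ hi hj := Nat.sub_le_sub_right (U.row_weak _ _ (congrArg (· + 1) hi) hj) 1
  col_strict c _ hj hi := by
    have hpos := U.col_strict ⟨c.1, (mem_cells_shrink.1 c.2).1⟩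
      ⟨(c.1.1 + 1, c.1.2), (mem_cells_shrink.1 c.2).2⟩ rfl (Nat.lt_succ_self _)
    exact Nat.sub_lt_sub_right (Nat.one_le_of_lt hpos)
      (U.col_strict _ _ hj (Nat.succ_lt_succ hi))

theorem peel_grow (T : A.shrink.SSYT) : T.grow.peel = T := by
  ext ⟨⟨i, j⟩, hc⟩
  simp [peel, entry_grow_succ T hc]

theorem grow_peel {U : A.SSYT} (hU : U.content 0 = A.numCols) : U.peel.grow = U := by
  ext ⟨⟨_ | i, j⟩, hc⟩
  · exact (entry_eq_zero_of_content_zero_eq hU _ fun _ _ _ => Nat.zero_le _).symm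
  · by_cases hij : (i, j) ∈ A.cells
    · have hpos := U.col_strict ⟨(i, j), hij⟩ ⟨(i + 1, j), hc⟩ rfl (Nat.lt_succ_self i)
      simp only [grow, hij, peel, dite_true]
      exact Nat.sub_add_cancel (Nat.one_le_of_lt hpos)
    · simp only [grow, hij, dite_false]
      refine (entry_eq_zero_of_content_zero_eq hU _ fun d hd hdj => ?_).symm
      obtain ⟨i', j'⟩ := d
      obtain rfl : j' = j := hdj
      by_contra! hlt
      exact hij (A.ordConnected_cells.out hd hc
        ⟨⟨Nat.le_of_lt_succ hlt, le_rfl⟩, ⟨Nat.le_succ i, le_rfl⟩⟩)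

end SSYT

theorem card_cells_eq_numCols_add (A : SkewShape) :
    A.cells.card = A.numCols + A.shrink.cells.card := by
  obtain ⟨T⟩ := (inferInstance : Nonempty A.shrink.SSYT)
  rw [← T.grow.degree_content, T.content_grow, degree_natCons, T.degree_content]

end SkewShape

theorem coeff_skewSchur (A : SkewShape) (d : ℕ →₀ ℕ) :
    MvPowerSeries.coeff d (skewSchur A) = Nat.card {T : A.SSYT // T.content = d} := rfl

theorem exists_content_eq_of_coeff_skewSchur_ne_zero {A : SkewShape} {d : ℕ →₀ ℕ}
    (h : MvPowerSeries.coeff d (skewSchur A) ≠ 0) : ∃ T : A.SSYT, T.content = d := by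
  rw [coeff_skewSchur, Nat.cast_ne_zero] at h
  exact nonempty_subtype.1 (Nat.card_ne_zero.1 h).1

theorem skewSchur_ne_zero (A : SkewShape) : skewSchur A ≠ 0 := by
  obtain ⟨T⟩ := (inferInstance : Nonempty A.SSYT)
  have hpos : Nat.card {U : A.SSYT // U.content = T.content} ≠ 0 :=
    Nat.card_ne_zero.2 ⟨⟨⟨T, rfl⟩⟩, inferInstance⟩
  intro h
  exact hpos (Nat.cast_eq_zero.1 ((coeff_skewSchur A T.content).symm.trans (by rw [h, map_zero])))

theorem headCoeff_skewSchur (A : SkewShape) :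
    headCoeff A.numCols (skewSchur A) = skewSchur A.shrink := by
  ext d
  rw [coeff_headCoeff, coeff_skewSchur, coeff_skewSchur]
  have hpeel {U : A.SSYT} (hU : U.content = natCons A.numCols d) : U.peel.grow = U :=
    SkewShape.SSYT.grow_peel (by rw [hU, natCons_zero])
  exact congrArg Nat.cast (Nat.card_congr
    { toFun := fun U => ⟨U.1.peel, natCons_right_injective A.numCols
        (by rw [← SkewShape.SSYT.content_grow, hpeel U.2, U.2])⟩
      invFun := fun T => ⟨T.1.grow, by rw [SkewShape.SSYT.content_grow, T.2]⟩
      left_inv := fun U => Subtype.ext (hpeel U.2)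
      right_inv := fun T => Subtype.ext T.1.peel_grow })

theorem headCoeff_skewSchur_of_lt {A : SkewShape} {m : ℕ} (h : A.numCols < m) :
    headCoeff m (skewSchur A) = 0 := by
  ext d
  by_contra hd
  obtain ⟨T, hT⟩ := exists_content_eq_of_coeff_skewSchur_ne_zero hd
  have := T.content_zero_le
  rw [hT, natCons_zero] at this
  exact this.not_gt h

/-! ### Families triangular in the powers of `x_0` -/

/-- A family of power series, such as the Schur functions or the fundamental quasisymmetric
functions, that is triangular with respect to the powers of `x_0`: in `b i`, the highest power of
`x_0` is `x_0 ^ head i`, and its coefficient is again a member of the family, `b (tail i)`.  The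
last four fields serve inductions along `tail`, which `size` makes terminate. -/
structure HeadTail {ι : Type*} (b : ι → MvPowerSeries ℕ ℚ) where
  head : ι → ℕ
  tail : ι → ι
  headCoeff_head (i : ι) : headCoeff (head i) (b i) = b (tail i)
  headCoeff_of_lt {i : ι} {m : ℕ} : head i < m → headCoeff m (b i) = 0
  ext {i j : ι} : head i = head j → tail i = tail j → i = j
  size : ι → ℕ
  size_tail_lt {i : ι} : 0 < head i → size (tail i) < size i
  eq_of_head_eq_zero {i j : ι} : head i = 0 → head j = 0 → i = j
  ne_zero_of_head_eq_zero {i : ι} : head i = 0 → b i ≠ 0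

/-- The skew Schur functions of `A` and `B` are linear combinations of the family `b` with the same
support. -/
def SameSupport {ι : Type*} (b : ι → MvPowerSeries ℕ ℚ) (A B : SkewShape) : Prop :=
  ∃ c c' : ι →₀ ℚ, Finsupp.linearCombination ℚ b c = skewSchur A ∧
    Finsupp.linearCombination ℚ b c' = skewSchur B ∧ c.support = c'.support

namespace HeadTail

variable {ι : Type*} {b : ι → MvPowerSeries ℕ ℚ} (H : HeadTail b) {A B : SkewShape} {c : ι →₀ ℚ}

/-- The coefficients, in the family `b`, of the coefficient of `x_0 ^ m` in the linear combination
`∑ c_i b_i`, provided that no higher power of `x_0` occurs in it. -/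
noncomputable def leading (m : ℕ) (c : ι →₀ ℚ) : ι →₀ ℚ :=
  (c.filter fun i => H.head i = m).mapDomain H.tail

theorem mem_support_leading {m : ℕ} {i : ι} :
    i ∈ (H.leading m c).support ↔ ∃ j ∈ c.support, H.head j = m ∧ H.tail j = i := by
  classical
  rw [leading, Finsupp.mapDomain_support_of_injOn]
  · simp [and_assoc]
  · intro i hi j hj
    simp only [Finsupp.support_filter, Finset.coe_filter, Set.mem_ofPred_eq] at hi hj
    exact H.ext (hi.2.trans hj.2.symm)

theorem headCoeff_linearCombination {m : ℕ} (h : ∀ i ∈ c.support, H.head i ≤ m) :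
    headCoeff m (Finsupp.linearCombination ℚ b c) =
      Finsupp.linearCombination ℚ b (H.leading m c) := by
  rw [leading, Finsupp.linearCombination_mapDomain, Finsupp.linearCombination_apply,
    Finsupp.linearCombination_apply, Finsupp.sum, Finsupp.sum, Finsupp.support_filter,
    Finset.sum_filter, map_sum]
  refine Finset.sum_congr rfl fun i hi => ?_
  rw [map_smul]
  split_ifs with hm
  · rw [Finsupp.filter_apply_pos (fun i => H.head i = m) c hm, Function.comp_apply,
      ← H.headCoeff_head, hm]
  · rw [H.headCoeff_of_lt ((h i hi).lt_of_ne hm), smul_zero]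

theorem eq_zero_of_linearCombination_eq_zero {N : ℕ} (hN : ∀ i ∈ c.support, H.size i ≤ N)
    (hc : Finsupp.linearCombination ℚ b c = 0) : c = 0 := by
  induction N using Nat.strong_induction_on generalizing c with
  | _ N ih =>
    by_contra hne
    obtain ⟨i, hi, hmax⟩ := Finset.exists_max_image c.support H.head
      (Finsupp.support_nonempty_iff.2 hne)
    rcases Nat.eq_zero_or_pos (H.head i) with hzero | hpos
    · have hsupp : c.support ⊆ {i} := fun j hj => Finset.mem_singleton.2
        (H.eq_of_head_eq_zero (Nat.le_zero.1 (hzero ▸ hmax j hj)) hzero)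
      rw [Finsupp.support_subset_singleton.1 hsupp, Finsupp.linearCombination_single] at hc
      exact (smul_ne_zero (Finsupp.mem_support_iff.1 hi) (H.ne_zero_of_head_eq_zero hzero)) hc
    · have hlead : H.leading (H.head i) c = 0 := by
        refine ih (N - 1) (by have := hN i hi; have := H.size_tail_lt hpos; omega) (fun k hk => ?_)
          (by rw [← H.headCoeff_linearCombination hmax, hc, map_zero])
        obtain ⟨j, hj, hji, rfl⟩ := H.mem_support_leading.1 hk
        exact Nat.le_sub_one_of_lt ((H.size_tail_lt (hji ▸ hpos)).trans_le (hN j hj))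
      have hmem := H.mem_support_leading.2 ⟨i, hi, rfl, rfl⟩
      simp [hlead] at hmem

include H in
theorem linearIndependent : LinearIndependent ℚ b :=
  linearIndependent_iff.2 fun _ =>
    H.eq_zero_of_linearCombination_eq_zero fun _ hi => Finset.le_sup (f := H.size) hi

theorem head_le_numCols (hc : Finsupp.linearCombination ℚ b c = skewSchur A) {i : ι}
    (hi : i ∈ c.support) : H.head i ≤ A.numCols := by
  obtain ⟨j, hj, hmax⟩ := Finset.exists_max_image c.support H.head ⟨i, hi⟩
  refine (hmax i hi).trans (not_lt.1 fun hlt => ?_)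
  have hlead : H.leading (H.head j) c = 0 := linearIndependent_iff.1 H.linearIndependent _
    (by rw [← H.headCoeff_linearCombination hmax, hc, headCoeff_skewSchur_of_lt hlt])
  have hmem := H.mem_support_leading.2 ⟨j, hj, rfl, rfl⟩
  simp [hlead] at hmem

theorem linearCombination_leading (hc : Finsupp.linearCombination ℚ b c = skewSchur A) :
    Finsupp.linearCombination ℚ b (H.leading A.numCols c) = skewSchur A.shrink := by
  rw [← H.headCoeff_linearCombination fun _ => H.head_le_numCols hc, hc, headCoeff_skewSchur]

theorem sup_head_eq_numCols (hc : Finsupp.linearCombination ℚ b c = skewSchur A) :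
    c.support.sup H.head = A.numCols := by
  refine (Finset.sup_le fun _ => H.head_le_numCols hc).antisymm ?_
  have hlead : H.leading A.numCols c ≠ 0 := fun h0 => skewSchur_ne_zero A.shrink
    (by rw [← H.linearCombination_leading hc, h0, map_zero])
  obtain ⟨i, hi⟩ := Finsupp.support_nonempty_iff.2 hlead
  obtain ⟨j, hj, hjA, -⟩ := H.mem_support_leading.1 hi
  exact hjA ▸ Finset.le_sup hj

include H in
theorem numCols_eq_of_sameSupport (h : SameSupport b A B) : A.numCols = B.numCols := by
  obtain ⟨c, c', hc, hc', hsupp⟩ := h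
  rw [← H.sup_head_eq_numCols hc, hsupp, H.sup_head_eq_numCols hc']

include H in
theorem sameSupport_shrink (h : SameSupport b A B) : SameSupport b A.shrink B.shrink := by
  have hcols := H.numCols_eq_of_sameSupport h
  obtain ⟨c, c', hc, hc', hsupp⟩ := h
  refine ⟨_, _, H.linearCombination_leading hc, H.linearCombination_leading hc', ?_⟩
  ext i
  rw [H.mem_support_leading, H.mem_support_leading, hcols, hsupp]

end HeadTail

theorem eq_bot_of_rowLen_eq_zero {ν : YoungDiagram} (h : ν.rowLen 0 = 0) : ν = ⊥ := by
  ext ⟨i, j⟩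
  simp only [YoungDiagram.mem_cells, YoungDiagram.notMem_bot, iff_false]
  intro hm
  have := YoungDiagram.mem_iff_lt_rowLen.1 (ν.up_left_mem (Nat.zero_le _) le_rfl hm)
  omega

theorem card_eq_rowLen_add_card_tailRows (ν : YoungDiagram) :
    ν.card = ν.rowLen 0 + (tailRows ν).card := by
  have hcard := (SkewShape.straight ν).card_cells_eq_numCols_add
  rwa [SkewShape.numCols_straight, SkewShape.shrink_straight, SkewShape.card_cells_straight,
    SkewShape.card_cells_straight] at hcard

theorem ext_rowLen_tailRows {ν ρ : YoungDiagram} (hhead : ν.rowLen 0 = ρ.rowLen 0)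
    (htail : tailRows ν = tailRows ρ) : ν = ρ := by
  ext ⟨i, j⟩
  rw [YoungDiagram.mem_cells, YoungDiagram.mem_cells]
  cases i with
  | zero => rw [YoungDiagram.mem_iff_lt_rowLen, YoungDiagram.mem_iff_lt_rowLen, hhead]
  | succ i => rw [← mem_tailRows, ← mem_tailRows, htail]

/-- In `s_ν`, the highest power of `x_0` has exponent `ν₁`, and its coefficient is the Schur
function of `(ν₂, ν₃, …)`. -/
noncomputable def schurHeadTail : HeadTail schur where
  head ν := ν.rowLen 0
  tail := tailRows
  headCoeff_head ν := by
    rw [schur, ← SkewShape.numCols_straight, headCoeff_skewSchur, SkewShape.shrink_straight, schur]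
  headCoeff_of_lt h := headCoeff_skewSchur_of_lt (by rwa [SkewShape.numCols_straight])
  ext := ext_rowLen_tailRows
  size := YoungDiagram.card
  size_tail_lt {ν} h := by
    rw [card_eq_rowLen_add_card_tailRows ν]
    omega
  eq_of_head_eq_zero hν hρ :=
    (eq_bot_of_rowLen_eq_zero hν).trans (eq_bot_of_rowLen_eq_zero hρ).symm
  ne_zero_of_head_eq_zero {ν} _ := skewSchur_ne_zero (SkewShape.straight ν)

/-! ### The Bender–Knuth involution -/

theorem rowLen_mono {μ ν : YoungDiagram} (h : μ ≤ ν) (r : ℕ) : μ.rowLen r ≤ ν.rowLen r := by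
  by_contra! hlt
  exact (YoungDiagram.mem_iff_lt_rowLen.1 (h (YoungDiagram.mem_iff_lt_rowLen.2 hlt))).false

theorem rowLen_eq_of_forall_mem_iff {μ : YoungDiagram} {r b : ℕ}
    (h : ∀ j, (r, j) ∈ μ ↔ j < b) : μ.rowLen r = b :=
  eq_of_forall_lt_iff fun j => by rw [← YoungDiagram.mem_iff_lt_rowLen, h]

theorem card_eq_sum_rowLen {μ : YoungDiagram} {N : ℕ} (hN : μ.rowLen N = 0) :
    μ.card = ∑ r ∈ Finset.range N, μ.rowLen r := by
  simp only [YoungDiagram.rowLen_eq_card]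
  refine Finset.card_eq_sum_card_fiberwise fun c hc => Finset.mem_coe.2 (Finset.mem_range.2 ?_)
  by_contra! hle
  have hmem : (N, 0) ∈ μ := μ.up_left_mem hle (Nat.zero_le _) (Finset.mem_coe.1 hc)
  rw [YoungDiagram.mem_iff_lt_rowLen, hN] at hmem
  exact hmem.false

namespace SkewShape.SSYT

variable {A : SkewShape}

/-- The Young diagram formed by the inner shape and the boxes of `T` with entry less than `t`. -/
def below (T : A.SSYT) (t : ℕ) : YoungDiagram where
  cells := A.inner.cells ∪
    (Finset.univ.filter fun c => T.entry c < t).map (Function.Embedding.subtype _)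
  isLowerSet c d hdc hc := by
    simp only [Finset.coe_union, Finset.coe_map, Set.mem_union, Finset.mem_coe, Set.mem_image,
      Finset.mem_filter, Finset.mem_univ, true_and, Function.Embedding.subtype_apply,
      YoungDiagram.mem_cells] at hc ⊢
    by_cases hd : d ∈ A.inner
    · exact Or.inl hd
    rcases hc with hc | ⟨c, hc, rfl⟩
    · exact absurd (A.inner.isLowerSet hdc hc) hd
    · have hd' : d ∈ A.cells := mem_cells.2 ⟨A.outer.isLowerSet hdc (mem_cells.1 c.2).1, hd⟩
      exact Or.inr ⟨⟨d, hd'⟩, (T.entry_le_of_le (c := ⟨d, hd'⟩) hdc).trans_lt hc, rfl⟩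

theorem mem_below {T : A.SSYT} {t : ℕ} {c : ℕ × ℕ} :
    c ∈ T.below t ↔ c ∈ A.inner ∨ ∃ hc : c ∈ A.cells, T.entry ⟨c, hc⟩ < t := by
  simp [← YoungDiagram.mem_cells, below, and_comm]

theorem mem_below_iff_entry_lt (T : A.SSYT) (t : ℕ) {c : ℕ × ℕ} (hc : c ∈ A.cells) :
    c ∈ T.below t ↔ T.entry ⟨c, hc⟩ < t := by
  simp [mem_below, hc, (mem_cells.1 hc).2]

theorem entry_lt_iff (T : A.SSYT) (t : ℕ) {r j : ℕ} (h : (r, j) ∈ A.cells) :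
    T.entry ⟨_, h⟩ < t ↔ j < (T.below t).rowLen r := by
  rw [← mem_below_iff_entry_lt, YoungDiagram.mem_iff_lt_rowLen]

theorem inner_le_below (T : A.SSYT) (t : ℕ) : A.inner ≤ T.below t :=
  fun _ hc => mem_below.2 (Or.inl hc)

theorem below_le_outer (T : A.SSYT) (t : ℕ) : T.below t ≤ A.outer := by
  intro c hc
  rcases mem_below.1 hc with hc | ⟨hc, -⟩
  exacts [A.inner_le_outer hc, (mem_cells.1 hc).1]

theorem below_mono (T : A.SSYT) : Monotone T.below := fun _ _ htu _ hc =>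
  mem_below.2 ((mem_below.1 hc).imp_right fun ⟨hc, hlt⟩ => ⟨hc, hlt.trans_le htu⟩)

theorem rowLen_below_succ_le (T : A.SSYT) (t r : ℕ) :
    (T.below (t + 1)).rowLen (r + 1) ≤ (T.below t).rowLen r := by
  refine not_lt.1 fun hlt => ?_
  set j := (T.below t).rowLen r
  have hj : (r, j) ∉ T.below t := fun h => (YoungDiagram.mem_iff_lt_rowLen.1 h).false
  have hj' := YoungDiagram.mem_iff_lt_rowLen.2 hlt
  have hup : ((r, j) : ℕ × ℕ) ≤ (r + 1, j) := ⟨Nat.le_succ r, le_rfl⟩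
  have hc : (r, j) ∈ A.cells := mem_cells.2
    ⟨A.outer.isLowerSet hup (T.below_le_outer _ hj'), fun h => hj (T.inner_le_below t h)⟩
  rcases mem_below.1 hj' with hd | ⟨hd, hlt'⟩
  · exact (mem_cells.1 hc).2 (A.inner.isLowerSet hup hd)
  · rw [mem_below_iff_entry_lt T t hc] at hj
    have := T.col_strict ⟨_, hc⟩ ⟨_, hd⟩ rfl (Nat.lt_succ_self r)
    omega

theorem content_add_card_below (T : A.SSYT) (t : ℕ) :
    T.content t + (T.below t).card = (T.below (t + 1)).card := by
  have hcard (u : ℕ) : (T.below u).card =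
      A.inner.cells.card + (Finset.univ.filter fun c => T.entry c < u).card := by
    rw [YoungDiagram.card, below, Finset.card_union_of_disjoint, Finset.card_map]
    rw [Finset.disjoint_left]
    intro c hc hc'
    obtain ⟨d, -, rfl⟩ := Finset.mem_map.1 hc'
    exact (mem_cells.1 d.2).2 hc
  have hsplit : (Finset.univ.filter fun c => T.entry c < t + 1) =
      (Finset.univ.filter fun c => T.entry c = t) ∪
        (Finset.univ.filter fun c => T.entry c < t) := by
    ext c
    simp [le_iff_eq_or_lt]
  rw [hcard, hcard, hsplit, Finset.card_union_of_disjoint, content_apply]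
  · omega
  · rw [Finset.disjoint_filter]
    omega

/-- The largest length of row `r` of `T.below (i + 1)` that the diagrams `T.below i` and
`T.below (i + 2)` allow. -/
noncomputable def maxRowLen (T : A.SSYT) (i : ℕ) : ℕ → ℕ
  | 0 => (T.below (i + 2)).rowLen 0
  | r + 1 => min ((T.below (i + 2)).rowLen (r + 1)) ((T.below i).rowLen r)

/-- The smallest length of row `r` of `T.below (i + 1)` that the diagrams `T.below i` and
`T.below (i + 2)` allow. -/
noncomputable def minRowLen (T : A.SSYT) (i r : ℕ) : ℕ :=
  max ((T.below i).rowLen r) ((T.below (i + 2)).rowLen (r + 1))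

theorem rowLen_below_le_maxRowLen (T : A.SSYT) (i r : ℕ) :
    (T.below (i + 1)).rowLen r ≤ T.maxRowLen i r := by
  have hle := rowLen_mono (T.below_mono (Nat.le_succ (i + 1))) r
  cases r with
  | zero => exact hle
  | succ r => exact le_min hle (T.rowLen_below_succ_le i r)

theorem minRowLen_le_rowLen_below (T : A.SSYT) (i r : ℕ) :
    T.minRowLen i r ≤ (T.below (i + 1)).rowLen r :=
  max_le (rowLen_mono (T.below_mono (Nat.le_succ i)) r) (T.rowLen_below_succ_le (i + 1) r)

theorem maxRowLen_le (T : A.SSYT) (i r : ℕ) : T.maxRowLen i r ≤ (T.below (i + 2)).rowLen r := by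
  cases r with
  | zero => exact le_rfl
  | succ r => exact min_le_left _ _

theorem sum_minRowLen_add_maxRowLen (T : A.SSYT) (i n : ℕ) :
    ∑ r ∈ Finset.range n, (T.minRowLen i r + T.maxRowLen i r) + T.maxRowLen i n =
      ∑ r ∈ Finset.range n, ((T.below i).rowLen r + (T.below (i + 2)).rowLen r) +
        (T.below (i + 2)).rowLen n := by
  induction n with
  | zero => simp [maxRowLen]
  | succ n ih =>
    have hn : T.minRowLen i n + T.maxRowLen i (n + 1) =
        (T.below i).rowLen n + (T.below (i + 2)).rowLen (n + 1) := by
      rw [minRowLen, maxRowLen, min_comm, max_add_min]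
    rw [Finset.sum_range_succ, Finset.sum_range_succ]
    omega

/-- The length of row `r` of `T.below (i + 1)` after the Bender–Knuth involution, which reflects the
interval of the possible lengths. -/
noncomputable def toggleRowLen (T : A.SSYT) (i r : ℕ) : ℕ :=
  T.minRowLen i r + T.maxRowLen i r - (T.below (i + 1)).rowLen r

theorem toggleRowLen_add (T : A.SSYT) (i r : ℕ) :
    T.toggleRowLen i r + (T.below (i + 1)).rowLen r = T.minRowLen i r + T.maxRowLen i r := by
  have := T.rowLen_below_le_maxRowLen i r
  unfold toggleRowLen
  omega

theorem minRowLen_le_toggleRowLen (T : A.SSYT) (i r : ℕ) :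
    T.minRowLen i r ≤ T.toggleRowLen i r := by
  have := T.rowLen_below_le_maxRowLen i r
  have := T.toggleRowLen_add i r
  omega

theorem toggleRowLen_le_maxRowLen (T : A.SSYT) (i r : ℕ) :
    T.toggleRowLen i r ≤ T.maxRowLen i r := by
  have := T.minRowLen_le_rowLen_below i r
  have := T.toggleRowLen_add i r
  omega

theorem rowLen_below_le_toggleRowLen (T : A.SSYT) (i r : ℕ) :
    (T.below i).rowLen r ≤ T.toggleRowLen i r :=
  (le_max_left _ _).trans (T.minRowLen_le_toggleRowLen i r)

theorem toggleRowLen_le_rowLen_below (T : A.SSYT) (i r : ℕ) :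
    T.toggleRowLen i r ≤ (T.below (i + 2)).rowLen r :=
  (T.toggleRowLen_le_maxRowLen i r).trans (T.maxRowLen_le i r)

/-- The Bender–Knuth involution, which exchanges the multiplicities of `i` and `i + 1`. -/
noncomputable def toggle (i : ℕ) (T : A.SSYT) : A.SSYT where
  entry c := if T.entry c = i ∨ T.entry c = i + 1 then
    (if c.1.2 < T.toggleRowLen i c.1.1 then i else i + 1) else T.entry c
  row_weak := by
    rintro ⟨⟨r, j⟩, hc⟩ ⟨⟨_, j'⟩, hd⟩ hr hj
    obtain rfl : r = _ := hr
    have hle : T.entry ⟨(r, j), hc⟩ ≤ T.entry ⟨(r, j'), hd⟩ := T.row_weak _ _ rfl hj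
    dsimp only at hj ⊢
    split_ifs <;> omega
  col_strict := by
    rintro ⟨⟨r, j⟩, hc⟩ ⟨⟨r', _⟩, hd⟩ hj hr
    obtain rfl : j = _ := hj
    dsimp only at hr ⊢
    have hlt : T.entry ⟨(r, j), hc⟩ < T.entry ⟨(r', j), hd⟩ := T.col_strict _ _ rfl hr
    by_cases hboth : T.entry ⟨_, hc⟩ = i ∧ T.entry ⟨_, hd⟩ = i + 1
    · obtain rfl : r' = r + 1 := by
        by_contra hne
        have hm : (r + 1, j) ∈ A.cells :=
          A.ordConnected_cells.out hc hd ⟨⟨Nat.le_succ r, le_rfl⟩, ⟨hr, le_rfl⟩⟩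
        have := T.col_strict ⟨_, hc⟩ ⟨_, hm⟩ rfl (Nat.lt_succ_self r)
        have := T.col_strict ⟨_, hm⟩ ⟨_, hd⟩ rfl (show r + 1 < r' by omega)
        omega
      have hupper : j < T.toggleRowLen i r :=
        ((T.entry_lt_iff (i + 2) hd).1 (by omega)).trans_le
          ((le_max_right _ _).trans (T.minRowLen_le_toggleRowLen i r))
      have hlower : ¬ j < T.toggleRowLen i (r + 1) := fun h => by
        have := (T.entry_lt_iff i hc).2
          (h.trans_le ((T.toggleRowLen_le_maxRowLen i (r + 1)).trans (min_le_right _ _)))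
        omega
      simp [hboth, hupper, hlower]
    · split_ifs <;> omega

theorem toggle_entry (i : ℕ) (T : A.SSYT) (c : A.cells) : (toggle i T).entry c =
    if T.entry c = i ∨ T.entry c = i + 1 then
      (if c.1.2 < T.toggleRowLen i c.1.1 then i else i + 1) else T.entry c := rfl

theorem below_toggle_of_ne {i t : ℕ} (T : A.SSYT) (h : t ≠ i + 1) :
    (toggle i T).below t = T.below t := by
  ext c
  simp only [YoungDiagram.mem_cells, mem_below, toggle_entry]
  refine or_congr_right (exists_congr fun hc => ?_)
  split_ifs <;> omega

theorem rowLen_below_toggle (i : ℕ) (T : A.SSYT) (r : ℕ) :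
    ((toggle i T).below (i + 1)).rowLen r = T.toggleRowLen i r := by
  refine rowLen_eq_of_forall_mem_iff fun j => ?_
  have hlower := T.rowLen_below_le_toggleRowLen i r
  have hupper := T.toggleRowLen_le_rowLen_below i r
  by_cases hc : (r, j) ∈ A.cells
  · have h := T.entry_lt_iff i hc
    have h' := T.entry_lt_iff (i + 2) hc
    rw [mem_below_iff_entry_lt _ _ hc, toggle_entry]
    dsimp only
    split_ifs <;> omega
  · have hinner := rowLen_mono (T.inner_le_below i) r
    have houter := rowLen_mono (T.below_le_outer (i + 2)) r
    rw [mem_below, YoungDiagram.mem_iff_lt_rowLen, or_iff_left fun ⟨hc', _⟩ => hc hc']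
    rw [mem_cells_iff_rowLen] at hc
    omega

theorem toggleRowLen_toggle (i : ℕ) (T : A.SSYT) (r : ℕ) :
    (toggle i T).toggleRowLen i r = (T.below (i + 1)).rowLen r := by
  have hi : (toggle i T).below i = T.below i := below_toggle_of_ne T (by omega)
  have hi' : (toggle i T).below (i + 2) = T.below (i + 2) := below_toggle_of_ne T (by omega)
  have hmin : (toggle i T).minRowLen i r = T.minRowLen i r := by rw [minRowLen, hi, hi', minRowLen]
  have hmax : (toggle i T).maxRowLen i r = T.maxRowLen i r := by
    cases r <;> simp only [maxRowLen, hi, hi']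
  have h := (toggle i T).toggleRowLen_add i r
  have h' := T.toggleRowLen_add i r
  rw [hmin, hmax, rowLen_below_toggle] at h
  omega

theorem toggle_toggle (i : ℕ) (T : A.SSYT) : toggle i (toggle i T) = T := by
  ext ⟨⟨r, j⟩, hc⟩
  rw [toggle_entry, toggleRowLen_toggle, toggle_entry]
  have h := T.entry_lt_iff (i + 1) hc
  dsimp only
  split_ifs <;> omega

theorem content_toggle_left (i : ℕ) (T : A.SSYT) :
    (toggle i T).content i = T.content (i + 1) := by
  set N := A.outer.colLen 0
  have hzero {μ : YoungDiagram} (hμ : μ ≤ A.outer) : μ.rowLen N = 0 := by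
    by_contra h
    exact (YoungDiagram.mem_iff_lt_colLen.1
      (hμ (YoungDiagram.mem_iff_lt_rowLen.2 (Nat.pos_of_ne_zero h)))).false
  have hcard (U : A.SSYT) (t : ℕ) : (U.below t).card = ∑ r ∈ Finset.range N, (U.below t).rowLen r :=
    card_eq_sum_rowLen (hzero (U.below_le_outer t))
  have hreflect : ((toggle i T).below (i + 1)).card + (T.below (i + 1)).card =
      (T.below i).card + (T.below (i + 2)).card := by
    have hmax : T.maxRowLen i N = 0 :=
      Nat.le_zero.1 ((T.maxRowLen_le i N).trans_eq (hzero (T.below_le_outer _)))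
    have hsum := T.sum_minRowLen_add_maxRowLen i N
    rw [hmax, hzero (T.below_le_outer _)] at hsum
    simp only [hcard, ← Finset.sum_add_distrib, rowLen_below_toggle, toggleRowLen_add]
    exact hsum
  have h := (toggle i T).content_add_card_below i
  have h' : T.content (i + 1) + (T.below (i + 1)).card = (T.below (i + 2)).card :=
    T.content_add_card_below (i + 1)
  rw [below_toggle_of_ne T (by omega)] at h
  omega

theorem content_toggle (i : ℕ) (T : A.SSYT) :
    (toggle i T).content = T.content.equivMapDomain (Equiv.swap i (i + 1)) := by
  ext t
  rw [Finsupp.equivMapDomain_apply, Equiv.symm_swap]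
  rcases eq_or_ne t i with rfl | hi
  · rw [Equiv.swap_apply_left, content_toggle_left]
  rcases eq_or_ne t (i + 1) with rfl | hi'
  · rw [Equiv.swap_apply_right, ← content_toggle_left, toggle_toggle]
  have h := (toggle i T).content_add_card_below t
  have h' := T.content_add_card_below t
  rw [below_toggle_of_ne T hi', below_toggle_of_ne T (by omega)] at h
  rw [Equiv.swap_apply_of_ne_of_ne hi hi']
  omega

end SkewShape.SSYT

theorem coeff_equivMapDomain_swap_skewSchur (A : SkewShape) (i : ℕ) (d : ℕ →₀ ℕ) :
    MvPowerSeries.coeff (d.equivMapDomain (Equiv.swap i (i + 1))) (skewSchur A) =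
      MvPowerSeries.coeff d (skewSchur A) := by
  have hinv (e : ℕ →₀ ℕ) : (e.equivMapDomain (Equiv.swap i (i + 1))).equivMapDomain
      (Equiv.swap i (i + 1)) = e := by
    ext t
    simp [Finsupp.equivMapDomain_apply]
  rw [coeff_skewSchur, coeff_skewSchur]
  exact congrArg Nat.cast (Nat.card_congr
    { toFun := fun T => ⟨T.1.toggle i, by rw [SkewShape.SSYT.content_toggle, T.2, hinv]⟩
      invFun := fun T => ⟨T.1.toggle i, by rw [SkewShape.SSYT.content_toggle, T.2]⟩
      left_inv := fun T => Subtype.ext (T.1.toggle_toggle i)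
      right_inv := fun T => Subtype.ext (T.1.toggle_toggle i) })

/-! ### Skew Schur functions as combinations of Schur functions -/

/-- The symmetric power series all of whose monomials have degree at most `n` and contain `x_0`, or
equivalently any other variable, at most to the power `m`. -/
def symmSeries (n m : ℕ) : Submodule ℚ (MvPowerSeries ℕ ℚ) where
  carrier := {f | (∀ (i : ℕ) (d : ℕ →₀ ℕ),
      MvPowerSeries.coeff (d.equivMapDomain (Equiv.swap i (i + 1))) f = MvPowerSeries.coeff d f) ∧
    ∀ d : ℕ →₀ ℕ, n < d.degree ∨ m < d 0 → MvPowerSeries.coeff d f = 0}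
  zero_mem' := ⟨fun _ _ => by simp, fun _ _ => map_zero _⟩
  add_mem' hf hg := ⟨fun i d => by rw [map_add, map_add, hf.1, hg.1],
    fun d hd => by rw [map_add, hf.2 d hd, hg.2 d hd, add_zero]⟩
  smul_mem' a _ hf := ⟨fun i d => by rw [map_smul, map_smul, hf.1],
    fun d hd => by rw [map_smul, hf.2 d hd, smul_zero]⟩

/-- The span of the Schur functions that belong to `symmSeries n m`. -/
noncomputable def schurSpan (n m : ℕ) : Submodule ℚ (MvPowerSeries ℕ ℚ) :=
  Submodule.span ℚ (schur '' {ν | ν.card ≤ n ∧ ν.rowLen 0 ≤ m})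

theorem skewSchur_mem_symmSeries (A : SkewShape) :
    skewSchur A ∈ symmSeries A.cells.card A.numCols := by
  refine ⟨coeff_equivMapDomain_swap_skewSchur A, fun d hd => ?_⟩
  by_contra hne
  obtain ⟨T, rfl⟩ := exists_content_eq_of_coeff_skewSchur_ne_zero hne
  have := T.degree_content
  have := T.content_zero_le
  omega

theorem symmSeries_mono {n n' m m' : ℕ} (hn : n ≤ n') (hm : m ≤ m') :
    symmSeries n m ≤ symmSeries n' m' :=
  fun _ hf => ⟨hf.1, fun d hd => hf.2 d (hd.imp hn.trans_lt hm.trans_lt)⟩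

theorem schurSpan_le_symmSeries (n m : ℕ) : schurSpan n m ≤ symmSeries n m := by
  refine Submodule.span_le.2 ?_
  rintro _ ⟨ν, ⟨hn, hm⟩, rfl⟩
  refine symmSeries_mono ?_ ?_ (skewSchur_mem_symmSeries (SkewShape.straight ν))
  exacts [(SkewShape.card_cells_straight ν).trans_le hn, (SkewShape.numCols_straight ν).trans_le hm]

theorem headCoeff_mem_symmSeries {n m : ℕ} {f : MvPowerSeries ℕ ℚ} (hf : f ∈ symmSeries n m) :
    headCoeff m f ∈ symmSeries (n - m) m := by
  refine ⟨fun i d => ?_, fun d hd => ?_⟩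
  · rw [coeff_headCoeff, coeff_headCoeff, ← hf.1 (i + 1)]
    congr 2
    ext (_ | t)
    · simp [Finsupp.equivMapDomain_apply, Equiv.swap_apply_of_ne_of_ne]
    · have hswap : Equiv.swap (i + 1) (i + 1 + 1) (t + 1) = Equiv.swap i (i + 1) t + 1 :=
        (Nat.succ_injective.swap_apply i (i + 1) t).trans rfl
      rw [Finsupp.equivMapDomain_apply, Equiv.symm_swap, hswap, natCons_succ, natCons_succ,
        Finsupp.equivMapDomain_apply, Equiv.symm_apply_apply]
  · rcases hd with hd | hd
    · refine hf.2 _ (Or.inl ?_)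
      rw [degree_natCons]
      omega
    · rw [coeff_headCoeff, ← hf.1 0]
      refine hf.2 _ (Or.inr ?_)
      rwa [Finsupp.equivMapDomain_apply, Equiv.symm_swap, Equiv.swap_apply_left, natCons_succ]

theorem mem_symmSeries_of_headCoeff_eq_zero {n m : ℕ} {f : MvPowerSeries ℕ ℚ}
    (hf : f ∈ symmSeries n (m + 1)) (hhead : headCoeff (m + 1) f = 0) : f ∈ symmSeries n m := by
  refine ⟨hf.1, fun d hd => ?_⟩
  rcases hd with hd | hd
  · exact hf.2 d (Or.inl hd)
  rcases (Nat.succ_le_of_lt hd).eq_or_lt with heq | hlt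
  · obtain ⟨d', hd'⟩ := exists_eq_natCons d
    rw [hd', ← heq, ← coeff_headCoeff, hhead, map_zero]
  · exact hf.2 d (Or.inr hlt)

theorem symmSeries_zero_le_schurSpan (n : ℕ) : symmSeries n 0 ≤ schurSpan n 0 := by
  have hvanish {k : ℕ} {f : MvPowerSeries ℕ ℚ} (hf : f ∈ symmSeries k 0) {d : ℕ →₀ ℕ}
      (hd : d ≠ 0) : MvPowerSeries.coeff d f = 0 := by
    obtain ⟨i, hi⟩ := Finsupp.ne_iff.1 hd
    clear hd
    induction i generalizing d with
    | zero => exact hf.2 d (Or.inr (Nat.pos_of_ne_zero hi))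
    | succ i ih =>
      rw [← hf.1 i d]
      refine ih ?_
      rwa [Finsupp.equivMapDomain_apply, Equiv.symm_swap, Equiv.swap_apply_left]
  have hbot : schur ⊥ ∈ schurSpan n 0 := Submodule.subset_span
    ⟨⊥, ⟨Nat.zero_le n, Nat.le_zero.2 (rowLen_eq_of_forall_mem_iff (by simp))⟩, rfl⟩
  have hcoeff : MvPowerSeries.coeff 0 (schur ⊥) ≠ 0 := fun h0 => by
    refine skewSchur_ne_zero (SkewShape.straight ⊥) (MvPowerSeries.ext fun d => ?_)
    rcases eq_or_ne d 0 with rfl | hd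
    exacts [h0, hvanish (schurSpan_le_symmSeries n 0 hbot) hd]
  intro f hf
  suffices h : f = (MvPowerSeries.coeff 0 f / MvPowerSeries.coeff 0 (schur ⊥)) • schur ⊥ from
    h ▸ Submodule.smul_mem _ _ hbot
  ext d
  rw [map_smul, smul_eq_mul]
  rcases eq_or_ne d 0 with rfl | hd
  · rw [div_mul_cancel₀ _ hcoeff]
  · rw [hvanish hf hd, hvanish (schurSpan_le_symmSeries n 0 hbot) hd, mul_zero]

theorem exists_rowLen_eq_tailRows_eq {m : ℕ} {ρ : YoungDiagram} (h : ρ.rowLen 0 ≤ m) :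
    ∃ ν : YoungDiagram, ν.rowLen 0 = m ∧ tailRows ν = ρ := by
  let ν : YoungDiagram :=
    { cells := (Finset.range (ρ.colLen 0 + 1) ×ˢ Finset.range m).filter
        fun c => c.1 = 0 ∨ (c.1 - 1, c.2) ∈ ρ
      isLowerSet := by
        rintro ⟨i, j⟩ ⟨i', j'⟩ ⟨hi, hj⟩ hc
        simp only [Finset.coe_filter, Finset.mem_product, Finset.mem_range,
          Set.mem_ofPred_eq] at hi hj hc ⊢
        exact ⟨⟨by omega, by omega⟩, hc.2.imp (by omega)
          (ρ.up_left_mem (Nat.sub_le_sub_right hi 1) hj)⟩ }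
  have hν {c : ℕ × ℕ} : c ∈ ν ↔
      (c.1 < ρ.colLen 0 + 1 ∧ c.2 < m) ∧ (c.1 = 0 ∨ (c.1 - 1, c.2) ∈ ρ) := by
    rw [← YoungDiagram.mem_cells, Finset.mem_filter, Finset.mem_product, Finset.mem_range,
      Finset.mem_range]
  refine ⟨ν, rowLen_eq_of_forall_mem_iff fun j => by simp [hν], ?_⟩
  ext ⟨i, j⟩
  simp only [YoungDiagram.mem_cells, mem_tailRows, hν, Nat.succ_ne_zero, false_or,
    Nat.add_sub_cancel, and_iff_right_iff_imp]
  intro hρ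
  have hcol := YoungDiagram.mem_iff_lt_colLen.1 (ρ.up_left_mem le_rfl (Nat.zero_le _) hρ)
  have hrow := YoungDiagram.mem_iff_lt_rowLen.1 (ρ.up_left_mem (Nat.zero_le _) le_rfl hρ)
  omega

theorem schurSpan_le_map_headCoeff {n m : ℕ} (h : m ≤ n) :
    schurSpan (n - m) m ≤ (schurSpan n m).map (headCoeff m) := by
  refine Submodule.span_le.2 ?_
  rintro _ ⟨ρ, ⟨hn, hm⟩, rfl⟩
  obtain ⟨ν, rfl, rfl⟩ := exists_rowLen_eq_tailRows_eq hm
  have hcard := card_eq_rowLen_add_card_tailRows ν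
  exact ⟨schur ν, Submodule.subset_span ⟨ν, ⟨by omega, le_rfl⟩, rfl⟩,
    schurHeadTail.headCoeff_head ν⟩

theorem symmSeries_le_schurSpan (n m : ℕ) : symmSeries n m ≤ schurSpan n m := by
  induction n using Nat.strong_induction_on generalizing m with
  | _ n ihn =>
  induction m with
  | zero => exact symmSeries_zero_le_schurSpan n
  | succ m ihm =>
    have hmono : schurSpan n m ≤ schurSpan n (m + 1) := Submodule.span_mono
      (Set.image_mono fun _ h => ⟨h.1, h.2.trans (Nat.le_succ m)⟩)
    intro f hf
    rcases Nat.lt_or_ge n (m + 1) with hlt | hge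
    · refine hmono (ihm ⟨hf.1, fun d hd => hf.2 d (Or.inl ?_)⟩)
      have := Finsupp.le_degree 0 d
      omega
    · obtain ⟨g, hg, hgf⟩ := schurSpan_le_map_headCoeff hge
        (ihn (n - (m + 1)) (by omega) (m + 1) (headCoeff_mem_symmSeries hf))
      have hsub : f - g ∈ schurSpan n m := ihm (mem_symmSeries_of_headCoeff_eq_zero
        (sub_mem hf (schurSpan_le_symmSeries _ _ hg)) (by rw [map_sub, hgf, sub_self]))
      exact sub_add_cancel f g ▸ add_mem (hmono hsub) hg

theorem exists_linearCombination_schur_eq_skewSchur (A : SkewShape) :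
    ∃ c : YoungDiagram →₀ ℚ, Finsupp.linearCombination ℚ schur c = skewSchur A := by
  obtain ⟨c, -, hc⟩ := (Finsupp.mem_span_image_iff_linearCombination ℚ).1
    (symmSeries_le_schurSpan _ _ (skewSchur_mem_symmSeries A))
  exact ⟨c, hc⟩

/-! ### Standardization -/

/-- The sum of the first `t` values of `d`. -/
def psum (d : ℕ →₀ ℕ) (t : ℕ) : ℕ := ∑ i ∈ Finset.range t, d i

theorem psum_succ (d : ℕ →₀ ℕ) (t : ℕ) : psum d (t + 1) = psum d t + d t :=
  Finset.sum_range_succ _ _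

theorem psum_mono (d : ℕ →₀ ℕ) : Monotone (psum d) := fun _ _ h =>
  Finset.sum_le_sum_of_subset (Finset.range_mono h)

theorem exists_psum_eq_degree (d : ℕ →₀ ℕ) : ∃ N, psum d N = d.degree := by
  refine ⟨d.support.sup id + 1, (Finset.sum_subset (fun i hi => ?_) fun i _ hi => ?_).symm⟩
  · exact Finset.mem_range_succ_iff.2 (Finset.le_sup (f := id) hi)
  · exact Finsupp.notMem_support_iff.1 hi

theorem psum_le_degree (d : ℕ →₀ ℕ) (t : ℕ) : psum d t ≤ d.degree := by
  rw [Finsupp.degree_apply, psum, ← Finset.sum_inter_add_sum_sdiff _ d.support,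
    Finset.sum_eq_zero (s := _ \ _) fun i hi =>
      Finsupp.notMem_support_iff.1 (Finset.mem_sdiff.1 hi).2, add_zero]
  exact Finset.sum_le_sum_of_subset Finset.inter_subset_right

/-- The index of the block containing the position `p`, when the positions `0, 1, …` are cut into
consecutive blocks of sizes `d 0, d 1, …`. -/
noncomputable def blockIndex (d : ℕ →₀ ℕ) (p : ℕ) : ℕ := sInf {t | p < psum d (t + 1)}

theorem lt_psum_blockIndex_succ {d : ℕ →₀ ℕ} {p : ℕ} (hp : p < d.degree) :
    p < psum d (blockIndex d p + 1) := by
  refine Nat.sInf_mem (s := {t | p < psum d (t + 1)}) ?_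
  obtain ⟨N, hN⟩ := exists_psum_eq_degree d
  exact ⟨N, (hN ▸ hp).trans_le (psum_mono d N.le_succ)⟩

theorem psum_blockIndex_le (d : ℕ →₀ ℕ) (p : ℕ) : psum d (blockIndex d p) ≤ p := by
  rcases h : blockIndex d p with _ | t
  · exact Nat.zero_le _
  · exact not_lt.1 (Nat.notMem_of_lt_sInf (s := {t | p < psum d (t + 1)})
      (h.symm ▸ t.lt_succ_self : t < blockIndex d p))

theorem blockIndex_eq_iff {d : ℕ →₀ ℕ} {p t : ℕ} (hp : p < d.degree) :
    blockIndex d p = t ↔ psum d t ≤ p ∧ p < psum d (t + 1) := by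
  constructor
  · rintro rfl
    exact ⟨psum_blockIndex_le d p, lt_psum_blockIndex_succ hp⟩
  · rintro ⟨hle, hlt⟩
    refine (Nat.sInf_le (s := {t | p < psum d (t + 1)}) hlt).antisymm (Nat.le_of_lt_succ ?_)
    exact (psum_mono d).reflect_lt <| hle.trans_lt (lt_psum_blockIndex_succ hp)

theorem blockIndex_mono {d : ℕ →₀ ℕ} {p q : ℕ} (hpq : p ≤ q) (hq : q < d.degree) :
    blockIndex d p ≤ blockIndex d q :=
  Nat.sInf_le (hpq.trans_lt (lt_psum_blockIndex_succ hq))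

open Classical in
/-- The positions at which the blocks of sizes `d 0, d 1, …` start, except for the position `0`. -/
noncomputable def breaks (d : ℕ →₀ ℕ) : Finset ℕ :=
  {x ∈ Finset.Ioo 0 d.degree | ∃ t, psum d t = x}

theorem mem_breaks {d : ℕ →₀ ℕ} {x : ℕ} :
    x ∈ breaks d ↔ x ∈ Finset.Ioo 0 d.degree ∧ ∃ t, psum d t = x := by
  classical exact Finset.mem_filter

theorem notMem_breaks_of_blockIndex_eq {d : ℕ →₀ ℕ} {p q i : ℕ} (hq : q < d.degree)
    (h : blockIndex d p = blockIndex d q) (hi : p < i) (hi' : i ≤ q) : i ∉ breaks d := by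
  rintro hb
  obtain ⟨-, t, rfl⟩ := mem_breaks.1 hb
  have hlt : blockIndex d p < t :=
    (psum_mono d).reflect_lt ((psum_blockIndex_le d p).trans_lt hi)
  have hle : t < blockIndex d q + 1 :=
    (psum_mono d).reflect_lt (hi'.trans_lt (lt_psum_blockIndex_succ hq))
  omega

namespace SkewShape

variable {A : SkewShape}

/-- Standard Young tableaux of skew shape `A`: the entries are `0, …, n - 1`, where `n` is the
number of boxes. -/
@[ext]
structure SYT (A : SkewShape) extends A.SSYT where
  injective : Function.Injective entry
  lt_card : ∀ c, entry c < A.cells.card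

namespace SYT

instance : Finite A.SYT :=
  Finite.of_injective (fun (T : A.SYT) c => (⟨T.entry c, T.lt_card c⟩ : Fin A.cells.card))
    fun _ _ h => SYT.ext (funext fun c => congrArg Fin.val (congrFun h c))

theorem exists_entry_eq (T : A.SYT) {p : ℕ} (hp : p < A.cells.card) : ∃ c, T.entry c = p := by
  have hbij : Function.Bijective fun c => (⟨T.entry c, T.lt_card c⟩ : Fin A.cells.card) :=
    (Fintype.bijective_iff_injective_and_card _).2
      ⟨fun c d h => T.injective (congrArg Fin.val h), by simp⟩
  obtain ⟨c, hc⟩ := hbij.2 ⟨p, hp⟩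
  exact ⟨c, congrArg Fin.val hc⟩

theorem card_filter_entry_mem (T : A.SYT) {s : Finset ℕ} (hs : s ⊆ Finset.range A.cells.card) :
    (Finset.univ.filter fun c => T.entry c ∈ s).card = s.card := by
  refine Finset.card_bij (fun c _ => T.entry c) (fun c hc => (Finset.mem_filter.1 hc).2)
    (fun c _ d _ h => T.injective h) fun p hp => ?_
  obtain ⟨c, rfl⟩ := T.exists_entry_eq (Finset.mem_range.1 (hs hp))
  exact ⟨c, by simpa using hp, rfl⟩

open Classical in
/-- The descents of a standard tableau: the positive `i` such that the entry `i` lies in a lower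
row than the entry `i - 1`. -/
noncomputable def descents (T : A.SYT) : Finset ℕ :=
  {i ∈ Finset.Ioo 0 A.cells.card |
    ∃ c d : A.cells, T.entry c + 1 = i ∧ T.entry d = i ∧ c.1.1 < d.1.1}

theorem descents_subset (T : A.SYT) : T.descents ⊆ Finset.Ioo 0 A.cells.card :=
  Finset.filter_subset _ _

theorem entry_mem_descents_iff (T : A.SYT) {c d : A.cells} (h : T.entry c + 1 = T.entry d) :
    T.entry d ∈ T.descents ↔ c.1.1 < d.1.1 := by
  rw [descents, Finset.mem_filter, Finset.mem_Ioo]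
  constructor
  · rintro ⟨-, c', d', hc, hd, hlt⟩
    obtain rfl : c' = c := T.injective (by omega)
    obtain rfl : d' = d := T.injective hd
    exact hlt
  · exact fun hlt => ⟨⟨by omega, T.lt_card d⟩, c, d, h, rfl, hlt⟩

theorem col_lt_iff_not_row_lt (T : A.SYT) {c d : A.cells} (h : T.entry c + 1 = T.entry d) :
    c.1.2 < d.1.2 ↔ ¬ c.1.1 < d.1.1 := by
  constructor
  · intro hcol hrow
    -- The box in the row of `d` and the column of `c` would need an entry strictly in between.
    have he : (d.1.1, c.1.2) ∈ A.cells :=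
      A.ordConnected_cells.out c.2 d.2 ⟨⟨hrow.le, le_rfl⟩, ⟨le_rfl, hcol.le⟩⟩
    have hce := T.col_strict c ⟨_, he⟩ rfl hrow
    have hed := (T.row_weak ⟨_, he⟩ d rfl hcol).lt_of_ne fun h' =>
      hcol.ne (Prod.ext_iff.1 (congrArg Subtype.val (T.injective (a₁ := ⟨_, he⟩) h'))).2
    omega
  · intro hrow
    by_contra hcol
    have := T.entry_le_of_le (c := d) (d := c) ⟨not_lt.1 hrow, not_lt.1 hcol⟩
    omega

theorem row_le_and_col_lt_of_forall_notMem_descents (T : A.SYT) {c d : A.cells}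
    (h : T.entry c < T.entry d) (hdes : ∀ i ∈ Finset.Ioc (T.entry c) (T.entry d), i ∉ T.descents) :
    d.1.1 ≤ c.1.1 ∧ c.1.2 < d.1.2 := by
  induction hq : T.entry d using Nat.strong_induction_on generalizing d with
  | h q ih =>
    subst hq
    obtain ⟨e, he⟩ := T.exists_entry_eq (p := T.entry d - 1) (by have := T.lt_card d; omega)
    have hed : T.entry e + 1 = T.entry d := by omega
    have hrow : ¬ e.1.1 < d.1.1 := by
      rw [← T.entry_mem_descents_iff hed]
      exact hdes _ (Finset.mem_Ioc.2 ⟨h, le_rfl⟩)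
    have hcol := (T.col_lt_iff_not_row_lt hed).2 hrow
    rcases (by omega : T.entry c ≤ T.entry e).eq_or_lt with hce | hce
    · obtain rfl := T.injective hce
      exact ⟨not_lt.1 hrow, hcol⟩
    · have := ih (T.entry e) (by omega) hce (fun i hi => hdes i
        (Finset.Ioc_subset_Ioc_right (by omega) hi)) rfl
      omega

theorem row_le_and_col_lt_of_blockIndex_eq (T : A.SYT) {d : ℕ →₀ ℕ} (hd : d.degree = A.cells.card)
    (hdes : T.descents ⊆ breaks d) {c e : A.cells} (h : T.entry c < T.entry e)
    (hb : blockIndex d (T.entry c) = blockIndex d (T.entry e)) :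
    e.1.1 ≤ c.1.1 ∧ c.1.2 < e.1.2 :=
  T.row_le_and_col_lt_of_forall_notMem_descents h fun _ hi hm =>
    notMem_breaks_of_blockIndex_eq (hd ▸ T.lt_card e) hb (Finset.mem_Ioc.1 hi).1
      (Finset.mem_Ioc.1 hi).2 (hdes hm)

/-- The semistandard tableau of content `d` whose standardization is `T`. -/
noncomputable def collapse (T : A.SYT) (d : ℕ →₀ ℕ) (hd : d.degree = A.cells.card)
    (hdes : T.descents ⊆ breaks d) : A.SSYT where
  entry c := blockIndex d (T.entry c)
  row_weak c e h h' := blockIndex_mono (T.row_weak c e h h') (hd ▸ T.lt_card e)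
  col_strict c e h h' := (blockIndex_mono (T.col_strict c e h h').le (hd ▸ T.lt_card e)).lt_of_ne
    fun hb => h'.not_ge
      (T.row_le_and_col_lt_of_blockIndex_eq hd hdes (T.col_strict c e h h') hb).1

theorem content_collapse (T : A.SYT) (d : ℕ →₀ ℕ) (hd : d.degree = A.cells.card)
    (hdes : T.descents ⊆ breaks d) : (T.collapse d hd hdes).content = d := by
  ext t
  have hs : Finset.Ico (psum d t) (psum d (t + 1)) ⊆ Finset.range A.cells.card := fun p hp =>
    Finset.mem_range.2 (hd ▸ (Finset.mem_Ico.1 hp).2.trans_le (psum_le_degree d _))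
  calc (T.collapse d hd hdes).content t
      = (Finset.univ.filter fun c =>
          T.entry c ∈ Finset.Ico (psum d t) (psum d (t + 1))).card := by
        rw [SSYT.content_apply]
        refine congrArg Finset.card (Finset.filter_congr fun c _ => ?_)
        rw [Finset.mem_Ico, ← blockIndex_eq_iff (hd ▸ T.lt_card c), collapse]
    _ = d t := by
        rw [T.card_filter_entry_mem hs, Nat.card_Ico, psum_succ, Nat.add_sub_cancel_left]

end SYT

namespace SSYT

/-- The order on boxes defining the standardization: by entry, then by column. -/
def readingKey (V : A.SSYT) (c : A.cells) : ℕ ×ₗ ℕ := toLex (V.entry c, c.1.2)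

theorem readingKey_lt_iff {V : A.SSYT} {c e : A.cells} : V.readingKey c < V.readingKey e ↔
    V.entry c < V.entry e ∨ V.entry c = V.entry e ∧ c.1.2 < e.1.2 :=
  Prod.Lex.toLex_lt_toLex

theorem readingKey_injective (V : A.SSYT) : Function.Injective V.readingKey := fun _ _ h =>
  have h' := Prod.ext_iff.1 (toLex.injective h)
  V.eq_of_entry_eq_of_col_eq h'.1 h'.2

/-- The number of boxes before `c` in the reading order of `V`. -/
def rank (V : A.SSYT) (c : A.cells) : ℕ :=
  (Finset.univ.filter fun x => V.readingKey x < V.readingKey c).card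

theorem rank_lt_rank_iff {V : A.SSYT} {c e : A.cells} :
    V.rank c < V.rank e ↔ V.readingKey c < V.readingKey e := by
  have hmono : ∀ {c e}, V.readingKey c ≤ V.readingKey e → V.rank c ≤ V.rank e := fun h =>
    Finset.card_le_card (Finset.monotone_filter_right _ fun _ _ hx => lt_of_lt_of_le hx h)
  refine ⟨fun h => not_le.1 fun h' => h.not_ge (hmono h'), fun h => ?_⟩
  refine Finset.card_lt_card ((Finset.ssubset_iff_of_subset
    (Finset.monotone_filter_right _ fun _ _ hx => hx.trans h)).2 ⟨c, by simpa using h, by simp⟩)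

/-- The standardization of a semistandard tableau. -/
def standardize (V : A.SSYT) : A.SYT where
  entry := V.rank
  row_weak c e h h' := (rank_lt_rank_iff.2 (readingKey_lt_iff.2
    ((V.row_weak c e h h').lt_or_eq.imp id fun h => ⟨h, h'⟩))).le
  col_strict c e h h' := rank_lt_rank_iff.2 (readingKey_lt_iff.2 (Or.inl (V.col_strict c e h h')))
  injective c e h := V.readingKey_injective <| le_antisymm
    (not_lt.1 fun h' => (rank_lt_rank_iff.2 h').ne' h)
    (not_lt.1 fun h' => (rank_lt_rank_iff.2 h').ne h)
  lt_card c := by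
    rw [← Fintype.card_coe A.cells, ← Finset.card_univ]
    exact Finset.card_lt_card (Finset.filter_ssubset.2 ⟨c, Finset.mem_univ c, lt_irrefl _⟩)

theorem card_filter_entry_lt (V : A.SSYT) (t : ℕ) :
    (Finset.univ.filter fun c => V.entry c < t).card = psum V.content t := by
  rw [psum, Finset.card_eq_sum_card_fiberwise (f := V.entry) (t := Finset.range t)
    fun c hc => by simpa using hc]
  refine Finset.sum_congr rfl fun i hi => ?_
  rw [content_apply, Finset.filter_filter]
  congr! with c
  exact and_iff_right_of_imp fun h => h.trans_lt (Finset.mem_range.1 hi)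

theorem psum_entry_le_rank (V : A.SSYT) (c : A.cells) : psum V.content (V.entry c) ≤ V.rank c := by
  rw [← card_filter_entry_lt]
  exact Finset.card_le_card
    (Finset.monotone_filter_right _ fun _ _ hx => readingKey_lt_iff.2 (Or.inl hx))

theorem rank_lt_psum_entry_succ (V : A.SSYT) (c : A.cells) :
    V.rank c < psum V.content (V.entry c + 1) := by
  rw [← card_filter_entry_lt]
  refine Finset.card_lt_card ((Finset.ssubset_iff_of_subset
    (Finset.monotone_filter_right _ fun x _ hx => ?_)).2 ⟨c, by simp, by simp⟩)
  rcases readingKey_lt_iff.1 hx with h | h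
  exacts [h.trans (Nat.lt_succ_self _), h.1.trans_lt (Nat.lt_succ_self _)]

theorem descents_standardize_subset (V : A.SSYT) : V.standardize.descents ⊆ breaks V.content := by
  intro i hi
  rw [SYT.descents, Finset.mem_filter] at hi
  obtain ⟨hin, c, e, hc, he, hrow⟩ := hi
  change V.rank c + 1 = i at hc
  change V.rank e = i at he
  rw [mem_breaks, degree_content]
  refine ⟨hin, V.entry e, ?_⟩
  have hlow := V.psum_entry_le_rank e
  have hup := V.rank_lt_psum_entry_succ c
  rcases readingKey_lt_iff.1 (rank_lt_rank_iff.1 (by omega : V.rank c < V.rank e)) with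
    h | ⟨h, hcol⟩
  · have : psum V.content (V.entry c + 1) ≤ _ := psum_mono V.content (Nat.succ_le_of_lt h)
    omega
  · exact absurd h (V.entry_lt_of_le ⟨hrow.le, hcol.le⟩ hrow).ne

theorem collapse_standardize (V : A.SSYT) : V.standardize.collapse V.content V.degree_content
    V.descents_standardize_subset = V := by
  ext c
  refine (blockIndex_eq_iff ?_).2 ⟨V.psum_entry_le_rank c, V.rank_lt_psum_entry_succ c⟩
  exact V.degree_content ▸ V.standardize.lt_card c

end SSYT

namespace SYT

theorem readingKey_collapse_lt_iff (T : A.SYT) {d : ℕ →₀ ℕ} (hd : d.degree = A.cells.card)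
    (hdes : T.descents ⊆ breaks d) {c e : A.cells} :
    (T.collapse d hd hdes).readingKey c < (T.collapse d hd hdes).readingKey e ↔
      T.entry c < T.entry e := by
  have hlt : ∀ {c e}, T.entry c < T.entry e →
      (T.collapse d hd hdes).readingKey c < (T.collapse d hd hdes).readingKey e := fun {c e} h =>
    SSYT.readingKey_lt_iff.2 <| (blockIndex_mono h.le (hd ▸ T.lt_card e)).lt_or_eq.imp id
      fun hb => ⟨hb, (T.row_le_and_col_lt_of_blockIndex_eq hd hdes h hb).2⟩
  refine ⟨fun h => lt_of_not_ge fun hle => ?_, hlt⟩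
  rcases hle.lt_or_eq with h' | h'
  · exact h.asymm (hlt h')
  · exact h.ne (congrArg _ (T.injective h').symm)

theorem standardize_collapse (T : A.SYT) {d : ℕ →₀ ℕ} (hd : d.degree = A.cells.card)
    (hdes : T.descents ⊆ breaks d) : (T.collapse d hd hdes).standardize = T := by
  refine SYT.ext (funext fun c => ?_)
  change SSYT.rank _ c = _
  have hs : Finset.range (T.entry c) ⊆ Finset.range A.cells.card :=
    Finset.range_mono (T.lt_card c).le
  simp only [SSYT.rank, T.readingKey_collapse_lt_iff]
  simpa only [Finset.mem_range, Finset.card_range] using T.card_filter_entry_mem hs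

/-- Standardization, as a bijection onto the standard tableaux whose descents are breaks of the
content. -/
noncomputable def collapseEquiv (d : ℕ →₀ ℕ) (hd : d.degree = A.cells.card) :
    {T : A.SYT // T.descents ⊆ breaks d} ≃ {V : A.SSYT // V.content = d} where
  toFun T := ⟨T.1.collapse d hd T.2, T.1.content_collapse d hd T.2⟩
  invFun V := ⟨V.1.standardize, V.1.descents_standardize_subset.trans_eq (congrArg breaks V.2)⟩
  left_inv T := Subtype.ext (T.1.standardize_collapse hd T.2)
  right_inv := by
    rintro ⟨V, rfl⟩
    exact Subtype.ext V.collapse_standardize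

end SYT

theorem card_cells_of_mem_iff_swap_mem {A B : SkewShape}
    (hAB : ∀ c, c ∈ B.cells ↔ c.swap ∈ A.cells) : B.cells.card = A.cells.card :=
  Finset.card_nbij' Prod.swap Prod.swap (fun c hc => (hAB c).1 hc)
    (fun c hc => (hAB _).2 (c.swap_swap.symm ▸ hc)) (fun c _ => c.swap_swap) fun c _ => c.swap_swap

namespace SYT

variable {B : SkewShape}

/-- The transpose of a standard tableau.  Its shape `B` is only required to have the boxes of
`A.transpose`, so that transposing twice needs no cast. -/
def transposeTo (hAB : ∀ c, c ∈ B.cells ↔ c.swap ∈ A.cells) (T : A.SYT) : B.SYT where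
  entry c := T.entry ⟨c.1.swap, (hAB _).1 c.2⟩
  row_weak _ _ h h' := (T.col_strict _ _ h h').le
  col_strict _ _ h h' := (T.row_weak _ _ h h').lt_of_ne fun heq =>
    h'.ne (Prod.ext_iff.1 (congrArg Subtype.val (T.injective heq))).2
  injective _ _ h := Subtype.ext (Prod.swap_injective (congrArg Subtype.val (T.injective h)))
  lt_card _ := card_cells_of_mem_iff_swap_mem hAB ▸ T.lt_card _

theorem descents_transposeTo (hAB : ∀ c, c ∈ B.cells ↔ c.swap ∈ A.cells) (T : A.SYT) :
    (T.transposeTo hAB).descents = Finset.Ioo 0 A.cells.card \ T.descents := by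
  have hcard := card_cells_of_mem_iff_swap_mem hAB
  ext i
  by_cases hi : i ∈ Finset.Ioo 0 A.cells.card
  · rw [Finset.mem_sdiff, and_iff_right hi]
    rw [Finset.mem_Ioo] at hi
    obtain ⟨c, hc⟩ := (T.transposeTo hAB).exists_entry_eq (p := i - 1) (by omega)
    obtain ⟨e, he⟩ := (T.transposeTo hAB).exists_entry_eq (p := i) (by omega)
    have hce : (T.transposeTo hAB).entry c + 1 = (T.transposeTo hAB).entry e := by omega
    rw [← he, entry_mem_descents_iff _ hce]
    change c.1.swap.2 < e.1.swap.2 ↔ T.entry ⟨e.1.swap, (hAB _).1 e.2⟩ ∉ T.descents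
    rw [T.entry_mem_descents_iff hce, T.col_lt_iff_not_row_lt hce]
  · exact iff_of_false (fun h => hi (hcard ▸ descents_subset _ h))
      fun h => hi (Finset.mem_sdiff.1 h).1

/-- Transposition as a bijection between standard tableaux. -/
def transposeEquiv : A.SYT ≃ A.transpose.SYT where
  toFun := transposeTo fun _ => mem_cells_transpose
  invFun := transposeTo fun c => by rw [mem_cells_transpose, c.swap_swap]
  left_inv _ := rfl
  right_inv _ := rfl

theorem descents_transposeEquiv (T : A.SYT) :
    T.transposeEquiv.descents = Finset.Ioo 0 A.cells.card \ T.descents :=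
  T.descents_transposeTo fun _ => mem_cells_transpose

end SYT

end SkewShape

/-! ### The coefficients of fundamental quasisymmetric functions -/

section Composition

variable {n : ℕ}

theorem mem_partialSums {α : Composition n} {x : ℕ} :
    x ∈ α.partialSums ↔ x ∈ Finset.Ioo 0 n ∧ ∃ k, α.sizeUpTo k = x := by
  have hstrict : ∀ {i j}, i < j → i < α.length → α.sizeUpTo i < α.sizeUpTo j := fun hij hi =>
    (α.sizeUpTo_strict_mono hi).trans_le (α.monotone_sizeUpTo hij)
  simp only [Composition.partialSums, Finset.mem_image, Finset.mem_Ico, Finset.mem_Ioo]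
  constructor
  · rintro ⟨k, ⟨hpos, hlt⟩, rfl⟩
    have h0 := hstrict hpos (hpos.trans hlt.le)
    have hn := hstrict hlt hlt
    rw [α.sizeUpTo_zero] at h0
    rw [α.sizeUpTo_length] at hn
    exact ⟨⟨h0, hn⟩, k, rfl⟩
  · rintro ⟨⟨h0, hn⟩, k, rfl⟩
    refine ⟨k, ⟨Nat.one_le_iff_ne_zero.2 ?_, not_le.1 fun hle => ?_⟩, rfl⟩
    · rintro rfl
      exact h0.ne' α.sizeUpTo_zero
    · exact hn.ne (α.sizeUpTo_ofLength_le k hle)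

theorem range_sizeUpTo (α : Composition n) :
    Set.range α.sizeUpTo = {0, n} ∪ (α.partialSums : Set ℕ) := by
  ext x
  simp only [Set.mem_range, Set.mem_union, Set.mem_insert_iff, Set.mem_singleton_iff,
    Finset.mem_coe, mem_partialSums, Finset.mem_Ioo]
  constructor
  · rintro ⟨k, rfl⟩
    have := α.sizeUpTo_le k
    grind
  · rintro ((rfl | rfl) | ⟨-, h⟩)
    exacts [⟨0, α.sizeUpTo_zero⟩, ⟨_, α.sizeUpTo_length⟩, h]

theorem range_psum (d : ℕ →₀ ℕ) :
    Set.range (psum d) = {0, d.degree} ∪ (breaks d : Set ℕ) := by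
  ext x
  simp only [Set.mem_range, Set.mem_union, Set.mem_insert_iff, Set.mem_singleton_iff,
    Finset.mem_coe, mem_breaks, Finset.mem_Ioo]
  constructor
  · rintro ⟨t, rfl⟩
    have := psum_le_degree d t
    grind
  · rintro ((rfl | rfl) | ⟨-, h⟩)
    exacts [⟨0, rfl⟩, exists_psum_eq_degree d, h]

theorem partialSums_subset_breaks_iff {α : Composition n} {d : ℕ →₀ ℕ} (hd : d.degree = n) :
    α.partialSums ⊆ breaks d ↔ Set.range α.sizeUpTo ⊆ Set.range (psum d) := by
  rw [range_sizeUpTo, range_psum, hd]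
  refine ⟨fun h => Set.union_subset_union_right _ (by exact_mod_cast h), fun h x hx => ?_⟩
  have hx' := Finset.mem_Ioo.1 (mem_partialSums.1 hx).1
  have := h (Or.inr hx)
  simp only [Set.mem_union, Set.mem_insert_iff, Set.mem_singleton_iff, Finset.mem_coe] at this
  exact this.resolve_left (by omega)

theorem partialSums_injective : Function.Injective (Composition.partialSums (n := n)) := by
  intro α β h
  refine (compositionEquiv n).injective (CompositionAsSet.ext ?_)
  have hmem : ∀ (γ : Composition n) (b : Fin (n + 1)),
      b ∈ γ.boundaries ↔ (b : ℕ) ∈ Set.range γ.sizeUpTo := by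
    intro γ b
    simp only [Composition.boundaries, Finset.mem_map, Finset.mem_univ, true_and]
    constructor
    · rintro ⟨k, rfl⟩
      exact ⟨k, rfl⟩
    · rintro ⟨k, hk⟩
      rcases le_total k γ.length with hle | hle
      · exact ⟨⟨k, Nat.lt_succ_of_le hle⟩, Fin.ext hk⟩
      · exact ⟨Fin.last _, Fin.ext (γ.sizeUpTo_length.trans
          ((γ.sizeUpTo_ofLength_le k hle).symm.trans hk))⟩
  change α.boundaries = β.boundaries
  ext b
  rw [hmem, hmem, range_sizeUpTo, range_sizeUpTo, h]

theorem partialSums_subset (α : Composition n) : α.partialSums ⊆ Finset.Ioo 0 n :=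
  fun _ hx => (mem_partialSums.1 hx).1

variable (n) in
/-- The correspondence between compositions `α` of `n` and subsets `S(α)` of `{1, …, n - 1}`. -/
noncomputable def partialSumsEquiv : Composition n ≃ (Finset.Ioo 0 n).powerset :=
  Equiv.ofBijective (fun α => ⟨α.partialSums, Finset.mem_powerset.2 (partialSums_subset α)⟩) <| by
    refine (Fintype.bijective_iff_injective_and_card _).2
      ⟨fun α β h => partialSums_injective (congrArg Subtype.val h), ?_⟩
    rw [composition_card, Fintype.card_coe, Finset.card_powerset, Nat.card_Ioo, Nat.sub_zero]

theorem partialSums_partialSumsEquiv_symm (S : (Finset.Ioo 0 n).powerset) :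
    ((partialSumsEquiv n).symm S).partialSums = S :=
  congrArg Subtype.val ((partialSumsEquiv n).apply_symm_apply S)

theorem sizeUpTo_eq_sum (α : Composition n) (k : ℕ) :
    α.sizeUpTo k = ∑ j : Fin α.length with j.1 < k, α.blocksFun j := by
  rw [Composition.sizeUpTo, ← List.sum_take_ofFn, α.ofFn_blocksFun]

/-- The exponent vector of the monomial `x_{i₁}^{α₁} ⋯ x_{i_k}^{α_k}` of `M_α`. -/
noncomputable def monomialExponent (α : Composition n) (i : Fin α.length ↪o ℕ) : ℕ →₀ ℕ :=
  ∑ j, Finsupp.single (i j) (α.blocksFun j)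

theorem degree_monomialExponent (α : Composition n) (i : Fin α.length ↪o ℕ) :
    (monomialExponent α i).degree = n := by
  rw [monomialExponent, map_sum]
  simp only [Finsupp.degree_single]
  exact α.sum_blocksFun

theorem monomialExponent_apply (α : Composition n) (i : Fin α.length ↪o ℕ) (t : ℕ) :
    monomialExponent α i t = ∑ j with i j = t, α.blocksFun j := by
  simp only [monomialExponent, Finsupp.finsetSum_apply, Finsupp.single_apply, Finset.sum_filter]

theorem support_monomialExponent (α : Composition n) (i : Fin α.length ↪o ℕ) :
    ((monomialExponent α i).support : Set ℕ) = Set.range i := by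
  ext t
  rw [Finset.mem_coe, Finsupp.mem_support_iff, monomialExponent_apply, ne_eq,
    Finset.sum_eq_zero_iff]
  simp [Nat.one_le_iff_ne_zero.1 (α.one_le_blocksFun _)]

theorem monomialExponent_injective (α : Composition n) :
    Function.Injective (monomialExponent α) := fun i i' h =>
  OrderEmbedding.range_inj.1 <| by
    rw [← support_monomialExponent, ← support_monomialExponent, h]

theorem psum_monomialExponent (α : Composition n) (i : Fin α.length ↪o ℕ) (t : ℕ) :
    psum (monomialExponent α i) t = ∑ j with i j < t, α.blocksFun j := by
  simp only [psum, monomialExponent_apply, Finset.sum_filter]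
  rw [Finset.sum_comm]
  simp

theorem range_psum_monomialExponent (α : Composition n) (i : Fin α.length ↪o ℕ) :
    Set.range (psum (monomialExponent α i)) = Set.range α.sizeUpTo := by
  have hsum : ∀ {t k}, (∀ j, i j < t ↔ j.1 < k) →
      psum (monomialExponent α i) t = α.sizeUpTo k := fun h => by
    simp only [psum_monomialExponent, sizeUpTo_eq_sum, h]
  refine (Set.range_subset_iff.2 fun t => ?_).antisymm (Set.range_subset_iff.2 fun k => ?_)
  · have hex : ∃ k, ∀ hk : k < α.length, t ≤ i ⟨k, hk⟩ := ⟨_, fun hk => hk.false.elim⟩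
    classical
    refine ⟨Nat.find hex, (hsum fun j => ⟨fun hj => not_le.1 fun hle => ?_, fun hj => ?_⟩).symm⟩
    · exact hj.not_ge ((Nat.find_spec hex (hle.trans_lt j.2)).trans (i.monotone hle))
    · obtain ⟨_, hlt⟩ := not_forall.1 (Nat.find_min hex hj)
      exact not_le.1 hlt
  · by_cases hk : k < α.length
    · exact ⟨i ⟨k, hk⟩, hsum fun j => i.lt_iff_lt⟩
    · rw [α.sizeUpTo_ofLength_le k (not_lt.1 hk)]
      obtain ⟨N, hN⟩ := exists_psum_eq_degree (monomialExponent α i)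
      exact ⟨N, hN.trans (degree_monomialExponent α i)⟩

theorem exists_monomialExponent_eq {d : ℕ →₀ ℕ} (hd : d.degree = n) :
    ∃ (α : Composition n) (i : Fin α.length ↪o ℕ), monomialExponent α i = d := by
  let e := d.support.orderIsoOfFin rfl
  have hsum : ∀ {M : Type} [AddCommMonoid M] (f : ℕ → M),
      ∑ j, f (e j) = ∑ t ∈ d.support, f t := fun f => by
    rw [← Finset.sum_coe_sort d.support, ← e.toEquiv.sum_comp]
    rfl
  let α : Composition n :=
    { blocks := List.ofFn fun j => d (e j)
      blocks_pos := fun hx => by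
        obtain ⟨j, rfl⟩ := (List.mem_ofFn' _ _).1 hx
        exact Nat.pos_of_ne_zero (Finsupp.mem_support_iff.1 (e j).2)
      blocks_sum := by rw [List.sum_ofFn, hsum d, ← hd, Finsupp.degree_apply] }
  have hlen : α.length = d.support.card := List.length_ofFn
  have hblocks : ∀ j, α.blocksFun j = d (e (Fin.cast hlen j)) := fun j => by
    simp only [Composition.blocksFun, α, List.get_eq_getElem, List.getElem_ofFn]
    rfl
  refine ⟨α, (Fin.castOrderIso hlen).toOrderEmbedding.trans (d.support.orderEmbOfFin rfl), ?_⟩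
  simp only [monomialExponent, hblocks]
  calc ∑ j, Finsupp.single (e (Fin.cast hlen j) : ℕ) (d (e (Fin.cast hlen j)))
      = ∑ j, Finsupp.single (e j : ℕ) (d (e j)) :=
        (finCongr hlen).sum_comp fun j => Finsupp.single (e j : ℕ) (d (e j))
    _ = d := (hsum fun t => Finsupp.single t (d t)).trans d.sum_single

end Composition

theorem breaks_monomialExponent {n : ℕ} (α : Composition n) (i : Fin α.length ↪o ℕ) :
    breaks (monomialExponent α i) = α.partialSums := by
  ext x
  have hx := Set.ext_iff.1 (range_psum_monomialExponent α i) x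
  rw [mem_breaks, mem_partialSums, degree_monomialExponent]
  exact and_congr_right fun _ => hx

theorem coeff_monomialQSym {n : ℕ} (α : Composition n) (d : ℕ →₀ ℕ) :
    MvPowerSeries.coeff d (monomialQSym α) =
      if d.degree = n ∧ breaks d = α.partialSums then 1 else 0 := by
  change (Nat.card {i // monomialExponent α i = d} : ℚ) = _
  split_ifs with h
  · obtain ⟨hd, hbreaks⟩ := h
    obtain ⟨β, i, rfl⟩ := exists_monomialExponent_eq hd
    obtain rfl : β = α := partialSums_injective ((breaks_monomialExponent β i).symm.trans hbreaks)
    rw [Nat.cast_eq_one, Nat.card_eq_one_iff_unique]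
    exact ⟨⟨fun x y => Subtype.ext (monomialExponent_injective β (x.2.trans y.2.symm))⟩, ⟨i, rfl⟩⟩
  · rw [Nat.cast_eq_zero, Nat.card_eq_zero]
    refine Or.inl ⟨?_⟩
    rintro ⟨i, rfl⟩
    exact h ⟨degree_monomialExponent α i, breaks_monomialExponent α i⟩

theorem coeff_fundamentalQSym (α : Σ n, Composition n) (d : ℕ →₀ ℕ) :
    MvPowerSeries.coeff d (fundamentalQSym α) =
      if d.degree = α.1 ∧ α.2.partialSums ⊆ breaks d then 1 else 0 := by
  rw [fundamentalQSym, map_sum]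
  simp only [coeff_monomialQSym]
  by_cases hd : d.degree = α.1
  · obtain ⟨β, i, rfl⟩ := exists_monomialExponent_eq hd
    simp only [degree_monomialExponent, breaks_monomialExponent, true_and,
      partialSums_injective.eq_iff, Finset.sum_ite_eq, Finset.mem_filter, Finset.mem_univ]
  · simp only [hd, false_and, if_false, Finset.sum_const_zero]

theorem fundamentalQSym_ne_zero (α : Σ n, Composition n) : fundamentalQSym α ≠ 0 := by
  intro h
  have hcoeff := coeff_fundamentalQSym α (monomialExponent α.2 (Fin.valOrderEmb _))
  rw [if_pos ⟨degree_monomialExponent _ _, (breaks_monomialExponent _ _).ge⟩, h, map_zero] at hcoeff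
  exact zero_ne_one hcoeff

theorem range_psum_natCons (m : ℕ) (d : ℕ →₀ ℕ) :
    Set.range (psum (natCons m d)) = insert 0 ((m + ·) '' Set.range (psum d)) := by
  have hsucc : ∀ t, psum (natCons m d) (t + 1) = m + psum d t := fun t => by
    simp only [psum, Finset.sum_range_succ', natCons_succ, natCons_zero, add_comm]
  rw [← Nat.range_of_succ, ← Set.range_comp, Set.insert_eq]
  exact congrArg _ (congrArg Set.range (funext hsucc))

/-- The first part of a composition, or `0` for the empty composition. -/
def firstPart (α : Σ n, Composition n) : ℕ := α.2.blocks.headD 0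

/-- The composition `(α₂, …, α_k)`. -/
def otherParts (α : Σ n, Composition n) : Σ n, Composition n :=
  ⟨α.2.blocks.tail.sum, α.2.blocks.tail, fun h => α.2.blocks_pos (List.mem_of_mem_tail h), rfl⟩

theorem size_eq_firstPart_add (α : Σ n, Composition n) :
    α.1 = firstPart α + (otherParts α).1 := by
  obtain ⟨n, l, hl, rfl⟩ := α
  cases l <;> rfl

theorem range_sizeUpTo_eq_insert (α : Σ n, Composition n) :
    Set.range α.2.sizeUpTo =
      insert 0 ((firstPart α + ·) '' Set.range (otherParts α).2.sizeUpTo) := by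
  have hsucc : ∀ k, α.2.sizeUpTo (k + 1) = firstPart α + (otherParts α).2.sizeUpTo k := fun k => by
    obtain ⟨n, l, hl, rfl⟩ := α
    cases l <;> simp [Composition.sizeUpTo, firstPart, otherParts]
  rw [← Nat.range_of_succ, ← Set.range_comp, Set.insert_eq, α.2.sizeUpTo_zero]
  exact congrArg _ (congrArg Set.range (funext hsucc))

theorem blocks_eq_nil_of_firstPart_eq_zero {α : Σ n, Composition n} (h : firstPart α = 0) :
    α.2.blocks = [] := by
  obtain ⟨n, _ | ⟨a, l⟩, hl, rfl⟩ := α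
  · rfl
  · exact absurd h (hl List.mem_cons_self).ne'

theorem ext_firstPart_otherParts {α β : Σ n, Composition n} (hfirst : firstPart α = firstPart β)
    (hothers : otherParts α = otherParts β) : α = β := by
  rw [Composition.sigma_eq_iff_blocks_eq] at hothers ⊢
  by_cases h : firstPart α = 0
  · rw [blocks_eq_nil_of_firstPart_eq_zero h, blocks_eq_nil_of_firstPart_eq_zero (hfirst ▸ h)]
  · have hcons : ∀ γ : Σ n, Composition n, firstPart γ ≠ 0 →
        γ.2.blocks = firstPart γ :: (otherParts γ).2.blocks := by
      rintro ⟨n, _ | ⟨a, l⟩, hl, rfl⟩ hγ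
      exacts [absurd rfl hγ, rfl]
    rw [hcons α h, hcons β (hfirst ▸ h), hfirst, hothers]

theorem headCoeff_firstPart (α : Σ n, Composition n) :
    headCoeff (firstPart α) (fundamentalQSym α) = fundamentalQSym (otherParts α) := by
  have hshift : ∀ {m : ℕ} {X Y : Set ℕ}, 0 ∈ Y →
      (insert 0 ((m + ·) '' X) ⊆ insert 0 ((m + ·) '' Y) ↔ X ⊆ Y) := by
    intro m X Y hY
    refine ⟨fun h x hx => ?_, fun h => Set.insert_subset_insert (Set.image_mono h)⟩
    rcases h (Or.inr ⟨x, hx, rfl⟩) with h0 | ⟨y, hy, hxy⟩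
    · rwa [(add_eq_zero.1 h0).2]
    · rwa [← add_left_cancel hxy]
  ext d
  rw [coeff_headCoeff, coeff_fundamentalQSym, coeff_fundamentalQSym]
  have hdeg : (natCons (firstPart α) d).degree = α.1 ↔ d.degree = (otherParts α).1 := by
    rw [degree_natCons, size_eq_firstPart_add, add_right_inj]
  refine if_congr ?_ rfl rfl
  rw [hdeg, and_congr_right_iff]
  intro hd
  rw [partialSums_subset_breaks_iff hd, partialSums_subset_breaks_iff (hdeg.2 hd),
    range_psum_natCons, range_sizeUpTo_eq_insert]
  exact hshift ⟨0, rfl⟩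

theorem headCoeff_of_firstPart_lt {α : Σ n, Composition n} {m : ℕ} (h : firstPart α < m) :
    headCoeff m (fundamentalQSym α) = 0 := by
  ext d
  rw [coeff_headCoeff, coeff_fundamentalQSym, map_zero, if_neg]
  rintro ⟨hd, hsub⟩
  rw [partialSums_subset_breaks_iff hd, range_sizeUpTo_eq_insert, range_psum_natCons] at hsub
  rcases hsub (Or.inr ⟨0, ⟨0, Composition.sizeUpTo_zero _⟩, rfl⟩) with h0 | ⟨y, -, hy⟩
  · have hsize : α.1 = 0 := by
      rw [← α.2.blocks_sum, blocks_eq_nil_of_firstPart_eq_zero h0, List.sum_nil]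
    rw [degree_natCons] at hd
    omega
  · simp only at hy
    omega

/-- In `F_α`, the highest power of `x_0` has exponent `α₁`, and its coefficient is the fundamental
quasisymmetric function of `(α₂, α₃, …)`. -/
def fundamentalHeadTail : HeadTail fundamentalQSym where
  head := firstPart
  tail := otherParts
  headCoeff_head := headCoeff_firstPart
  headCoeff_of_lt := headCoeff_of_firstPart_lt
  ext := ext_firstPart_otherParts
  size α := α.1
  size_tail_lt {α} h := by
    have := size_eq_firstPart_add α
    omega
  eq_of_head_eq_zero hα hβ := Composition.sigma_eq_iff_blocks_eq.2 <|
    (blocks_eq_nil_of_firstPart_eq_zero hα).trans (blocks_eq_nil_of_firstPart_eq_zero hβ).symm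
  ne_zero_of_head_eq_zero _ := fundamentalQSym_ne_zero _

/-! ### The involution `ω` -/

namespace SkewShape.SYT

variable {A : SkewShape}

/-- The composition `α` whose set `S(α)` of partial sums is the descent set of `T`. -/
noncomputable def descentComposition (T : A.SYT) : Composition A.cells.card :=
  (partialSumsEquiv _).symm ⟨T.descents, Finset.mem_powerset.2 T.descents_subset⟩

theorem partialSums_descentComposition (T : A.SYT) :
    T.descentComposition.partialSums = T.descents :=
  partialSums_partialSumsEquiv_symm _

noncomputable instance : Fintype A.SYT := Fintype.ofFinite _

end SkewShape.SYT

theorem skewSchur_eq_sum_fundamentalQSym (A : SkewShape) :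
    skewSchur A = ∑ T : A.SYT, fundamentalQSym ⟨_, T.descentComposition⟩ := by
  ext d
  simp only [map_sum, coeff_fundamentalQSym, SkewShape.SYT.partialSums_descentComposition,
    coeff_skewSchur]
  by_cases hd : d.degree = A.cells.card
  · simp only [hd, true_and, Finset.sum_boole, ← Nat.card_congr (SkewShape.SYT.collapseEquiv d hd)]
    rw [Nat.card_eq_fintype_card, Fintype.card_subtype]
  · simp only [hd, false_and, if_false, Finset.sum_const_zero, Nat.cast_eq_zero]
    exact Nat.card_eq_zero.2 (Or.inl ⟨fun V => hd (V.2 ▸ V.1.degree_content)⟩)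

theorem exists_linearCombination_fundamentalQSym_eq_skewSchur (A : SkewShape) :
    ∃ c : (Σ n, Composition n) →₀ ℚ,
      Finsupp.linearCombination ℚ fundamentalQSym c = skewSchur A ∧ 0 ≤ c := by
  refine ⟨∑ T : A.SYT, Finsupp.single ⟨_, T.descentComposition⟩ 1, ?_, ?_⟩
  · simp only [map_sum, Finsupp.linearCombination_single, one_smul,
      skewSchur_eq_sum_fundamentalQSym]
  · exact Finset.sum_nonneg fun T _ => Finsupp.single_nonneg.2 zero_le_one

/-- The composition `ω(α)` with `S(ω(α))` the complement of `S(α)`. -/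
noncomputable def complComposition (α : Σ n, Composition n) : Σ n, Composition n :=
  ⟨α.1, (partialSumsEquiv α.1).symm
    ⟨Finset.Ioo 0 α.1 \ α.2.partialSums, Finset.mem_powerset.2 Finset.sdiff_subset⟩⟩

theorem partialSums_complComposition (α : Σ n, Composition n) :
    (complComposition α).2.partialSums = Finset.Ioo 0 α.1 \ α.2.partialSums :=
  partialSums_partialSumsEquiv_symm _

theorem complComposition_involutive : Function.Involutive complComposition := by
  rintro ⟨n, α⟩
  refine congrArg (Sigma.mk n) (partialSums_injective ?_)
  change (complComposition (complComposition ⟨n, α⟩)).2.partialSums = _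
  rw [partialSums_complComposition, partialSums_complComposition]
  exact Finset.sdiff_sdiff_eq_self (partialSums_subset α)

theorem sigma_eq_of_partialSums_eq {α β : Σ n, Composition n} (hsize : α.1 = β.1)
    (hsums : α.2.partialSums = β.2.partialSums) : α = β := by
  obtain ⟨m, α⟩ := α
  obtain ⟨n, β⟩ := β
  obtain rfl : m = n := hsize
  exact congrArg (Sigma.mk m) (partialSums_injective hsums)

theorem mk_descentComposition_transposeEquiv {A : SkewShape} (T : A.SYT) :
    (⟨_, T.transposeEquiv.descentComposition⟩ : Σ n, Composition n) =
      complComposition ⟨_, T.descentComposition⟩ := by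
  refine sigma_eq_of_partialSums_eq ?_ ?_
  · exact SkewShape.card_cells_of_mem_iff_swap_mem fun _ => SkewShape.mem_cells_transpose
  · rw [partialSums_complComposition]
    simp only [SkewShape.SYT.partialSums_descentComposition, SkewShape.SYT.descents_transposeEquiv]

theorem exists_linearMap_fundamentalQSym_complComposition :
    ∃ ω : MvPowerSeries ℕ ℚ →ₗ[ℚ] MvPowerSeries ℕ ℚ,
      ∀ α, ω (fundamentalQSym α) = fundamentalQSym (complComposition α) := by
  have hli := fundamentalHeadTail.linearIndependent
  obtain ⟨ω, hω⟩ := LinearMap.exists_extend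
    (Finsupp.linearCombination ℚ (fundamentalQSym ∘ complComposition) ∘ₗ hli.repr)
  refine ⟨ω, fun α => ?_⟩
  let x : Submodule.span ℚ (Set.range fundamentalQSym) :=
    ⟨fundamentalQSym α, Submodule.subset_span ⟨α, rfl⟩⟩
  calc ω x = Finsupp.linearCombination ℚ (fundamentalQSym ∘ complComposition) (hli.repr x) :=
        LinearMap.congr_fun hω x
    _ = fundamentalQSym (complComposition α) := by
        rw [hli.repr_eq_single α x rfl, Finsupp.linearCombination_single, one_smul,
          Function.comp_apply]

theorem map_skewSchur_eq_skewSchur_transpose {ω : MvPowerSeries ℕ ℚ →ₗ[ℚ] MvPowerSeries ℕ ℚ}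
    (hω : ∀ α, ω (fundamentalQSym α) = fundamentalQSym (complComposition α)) (A : SkewShape) :
    ω (skewSchur A) = skewSchur A.transpose := by
  simp only [skewSchur_eq_sum_fundamentalQSym, map_sum, hω,
    ← mk_descentComposition_transposeEquiv]
  exact SkewShape.SYT.transposeEquiv.sum_comp
    fun T : A.transpose.SYT => fundamentalQSym ⟨_, T.descentComposition⟩

theorem SameSupport.map {ι : Type*} {b : ι → MvPowerSeries ℕ ℚ} {A B A' B' : SkewShape}
    {ω : MvPowerSeries ℕ ℚ →ₗ[ℚ] MvPowerSeries ℕ ℚ} {f : ι → ι} (hf : Function.Injective f)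
    (hb : ∀ i, ω (b i) = b (f i)) (hA : ω (skewSchur A) = skewSchur A')
    (hB : ω (skewSchur B) = skewSchur B') (h : SameSupport b A B) : SameSupport b A' B' := by
  classical
  have hmap : ∀ c : ι →₀ ℚ, Finsupp.linearCombination ℚ b (c.mapDomain f) =
      ω (Finsupp.linearCombination ℚ b c) := fun c => by
    rw [Finsupp.linearCombination_mapDomain, LinearMap.map_finsupp_linearCombination]
    exact congrArg (Finsupp.linearCombination ℚ · c) (funext fun i => (hb i).symm)
  obtain ⟨c, c', hc, hc', hsupp⟩ := h
  refine ⟨c.mapDomain f, c'.mapDomain f, by rw [hmap, hc, hA], by rw [hmap, hc', hB], ?_⟩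
  rw [Finsupp.mapDomain_support_of_injective hf, Finsupp.mapDomain_support_of_injective hf, hsupp]

theorem sameSupport_schur_transpose {A B : SkewShape} (h : SameSupport schur A B) :
    SameSupport schur A.transpose B.transpose := by
  obtain ⟨ω, hω⟩ := exists_linearMap_fundamentalQSym_complComposition
  have hskew := map_skewSchur_eq_skewSchur_transpose hω
  refine h.map YoungDiagram.transposeOrderIso.injective (fun ν => ?_) (hskew A) (hskew B)
  exact (hskew _).trans (congrArg skewSchur (SkewShape.transpose_straight ν))

theorem sameSupport_fundamentalQSym_transpose {A B : SkewShape}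
    (h : SameSupport fundamentalQSym A B) :
    SameSupport fundamentalQSym A.transpose B.transpose := by
  obtain ⟨ω, hω⟩ := exists_linearMap_fundamentalQSym_complComposition
  have hskew := map_skewSchur_eq_skewSchur_transpose hω
  exact h.map complComposition_involutive.injective hω (hskew A) (hskew B)

/-! ### Supports -/

theorem cells_eq_empty_of_numCols_eq_zero {A : SkewShape} (h : A.numCols = 0) : A.cells = ∅ :=
  Finset.image_eq_empty.1 (Finset.card_eq_zero.1 h)

section InvariantRelation

variable {R : SkewShape → SkewShape → Prop}
  (hcols : ∀ {A B}, R A B → A.numCols = B.numCols)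
  (hshrink : ∀ {A B}, R A B → R A.shrink B.shrink)

include hcols hshrink

theorem card_cells_eq_of_relation {A B : SkewShape} (h : R A B) :
    A.cells.card = B.cells.card := by
  induction hn : A.cells.card using Nat.strong_induction_on generalizing A B with
  | _ n ih =>
    have hAB := hcols h
    rcases Nat.eq_zero_or_pos A.numCols with hA | hA
    · rw [← hn, cells_eq_empty_of_numCols_eq_zero hA,
        cells_eq_empty_of_numCols_eq_zero (hAB ▸ hA)]
    · have hcardA := A.card_cells_eq_numCols_add
      have hcardB := B.card_cells_eq_numCols_add
      have := ih _ (by omega) (hshrink h) rfl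
      omega

theorem rects_eq_of_relation (htrans : ∀ {A B}, R A B → R A.transpose B.transpose)
    {A B : SkewShape} (h : R A B) {k l : ℕ} (hk : 1 ≤ k) (hl : 1 ≤ l) :
    A.rects k l = B.rects k l := by
  induction k, hk using Nat.le_induction generalizing A B with
  | base =>
    induction l, hl using Nat.le_induction generalizing A B with
    | base => rw [A.rects_one_one, B.rects_one_one, card_cells_eq_of_relation hcols hshrink h]
    | succ l hl ih =>
      rw [A.rects_succ_right le_rfl hl, B.rects_succ_right le_rfl hl]
      exact ih (htrans (hshrink (htrans h)))
  | succ k hk ih =>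
    rw [A.rects_succ_left hk hl, B.rects_succ_left hk hl]
    exact ih (hshrink h)

end InvariantRelation

theorem schurSupport_eq_support {A : SkewShape} {c : YoungDiagram →₀ ℚ}
    (hc : Finsupp.linearCombination ℚ schur c = skewSchur A) : schurSupport A = c.support := by
  have huniq := linearIndependent_iff_injective_finsuppLinearCombination.1
    schurHeadTail.linearIndependent
  ext ν
  rw [Finset.mem_coe, Finsupp.mem_support_iff]
  exact ⟨fun ⟨c', hc', hν⟩ => huniq (hc'.trans hc.symm) ▸ hν, fun hν => ⟨c, hc, hν⟩⟩

theorem fundamentalSupport_eq_support {A : SkewShape} {c : (Σ n, Composition n) →₀ ℚ}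
    (hc : Finsupp.linearCombination ℚ fundamentalQSym c = skewSchur A) (hpos : 0 ≤ c) :
    fundamentalSupport A = c.support := by
  have huniq := linearIndependent_iff_injective_finsuppLinearCombination.1
    fundamentalHeadTail.linearIndependent
  ext α
  have hnonneg : 0 ≤ c α := hpos α
  rw [Finset.mem_coe, Finsupp.mem_support_iff, ← hnonneg.lt_iff_ne']
  exact ⟨fun ⟨c', hc', hα⟩ => huniq (hc'.trans hc.symm) ▸ hα, fun hα => ⟨c, hc, hα⟩⟩

theorem sameSupport_schur_of_skewSchur_eq {A B : SkewShape} (h : skewSchur A = skewSchur B) :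
    SameSupport schur A B := by
  obtain ⟨c, hc⟩ := exists_linearCombination_schur_eq_skewSchur A
  exact ⟨c, c, hc, hc.trans h, rfl⟩

theorem sameSupport_schur_of_schurSupport_eq {A B : SkewShape}
    (h : schurSupport A = schurSupport B) : SameSupport schur A B := by
  obtain ⟨c, hc⟩ := exists_linearCombination_schur_eq_skewSchur A
  obtain ⟨c', hc'⟩ := exists_linearCombination_schur_eq_skewSchur B
  rw [schurSupport_eq_support hc, schurSupport_eq_support hc'] at h
  exact ⟨c, c', hc, hc', Finset.coe_injective h⟩

theorem sameSupport_fundamentalQSym_of_fundamentalSupport_eq {A B : SkewShape}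
    (h : fundamentalSupport A = fundamentalSupport B) : SameSupport fundamentalQSym A B := by
  obtain ⟨c, hc, hpos⟩ := exists_linearCombination_fundamentalQSym_eq_skewSchur A
  obtain ⟨c', hc', hpos'⟩ := exists_linearCombination_fundamentalQSym_eq_skewSchur B
  rw [fundamentalSupport_eq_support hc hpos, fundamentalSupport_eq_support hc' hpos'] at h
  exact ⟨c, c', hc, hc', Finset.coe_injective h⟩

theorem rects_eq_of_sameSupport_schur {A B : SkewShape} (h : SameSupport schur A B) {k l : ℕ}
    (hk : 1 ≤ k) (hl : 1 ≤ l) : A.rects k l = B.rects k l :=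
  rects_eq_of_relation schurHeadTail.numCols_eq_of_sameSupport schurHeadTail.sameSupport_shrink
    sameSupport_schur_transpose h hk hl

theorem rects_eq_of_sameSupport_fundamentalQSym {A B : SkewShape}
    (h : SameSupport fundamentalQSym A B) {k l : ℕ} (hk : 1 ≤ k) (hl : 1 ≤ l) :
    A.rects k l = B.rects k l :=
  rects_eq_of_relation fundamentalHeadTail.numCols_eq_of_sameSupport
    fundamentalHeadTail.sameSupport_shrink sameSupport_fundamentalQSym_transpose h hk hl

theorem corollary4p3 (A B : SkewShape)
    (h : skewSchur A = skewSchur B ∨ schurSupport A = schurSupport B ∨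
      fundamentalSupport A = fundamentalSupport B) :
    (∀ k : ℕ, 1 ≤ k → A.rowsk k = B.rowsk k) ∧
    (∀ l : ℕ, 1 ≤ l → A.colsk l = B.colsk l) ∧
    (∀ k l : ℕ, 1 ≤ k → 1 ≤ l → A.rects k l = B.rects k l) := by
  have hrects : ∀ k l : ℕ, 1 ≤ k → 1 ≤ l → A.rects k l = B.rects k l := fun k l hk hl => by
    rcases h with h | h | h
    · exact rects_eq_of_sameSupport_schur (sameSupport_schur_of_skewSchur_eq h) hk hl
    · exact rects_eq_of_sameSupport_schur (sameSupport_schur_of_schurSupport_eq h) hk hl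
    · exact rects_eq_of_sameSupport_fundamentalQSym
        (sameSupport_fundamentalQSym_of_fundamentalSupport_eq h) hk hl
  exact ⟨fun k hk => SkewShape.rowsk_eq_of_rects_eq hk fun l hl => hrects k l hk hl,
    fun l hl => SkewShape.colsk_eq_of_rects_eq hl fun k hk => hrects k l hk hl, hrects⟩
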